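/- **Setting.** Interest rates are zero; withdrawals take place at dates $t=1,\dots,N$. Under the pricing measure $\mathbb Q$ the asset price $(S_t)$, $S_0=1$, is a nonnegative martingale for a filtration $(\mathcal F_t)$. Assume * (A1) for $t<N$, $S$ is Markov with transition kernel $\kappa_t(s,\cdot)$ from $t$ to $t+1$, carried by $[0,\infty)$ for $s\ge 0$, and for $s>0$ the law $\kappa_t(s,\cdot)$ is absolutely continuous on $(0,\infty)$ (an atom at $0$ is allowed); * (A2) $P_t(aK\,|\,as)=a\,P_t(K\,|\,s)$ for all $t<N$ and $a,K,s>0$, where $P_t(K|x)=\int (K-y)^+\kappa_t(x,dy)$ and $C_t(K|x)=\int (y-K)^+\kappa_t(x,dy)$ are the one-period put and call values; $\Delta^P_t,\Delta^C_t$ denote their first derivatives and $\Gamma_t(K|x)$ the second derivative of the put with respect to the spot $x$. Let $A_1,\dots,A_{N-1}>0$ be a guarantee base (formally $A_N=\infty$), $X_0>0$, $w_0>0$, $X_{t+1}=X_tS_{t+1}/S_t-w_t$, $w_t=\max(w_{t-1},X_t/A_t)$ for $1\le t\le N-1$, $w_N=w_{N-1}$, $\tau=\inf\{t\le N:X_t\le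 0\}$, $Z^{(0)}=0$, $Z^{(t)}=w_{t-1}1_{\tau\le t-1}+X_t^-1_{\tau=t}$, and $V_t=\mathbb E^{\mathbb Q}[\sum_{u=t}^N Z^{(u)}\,|\,\mathcal F_t]$. Define backwards for $t\le N$ the value function (when $\tau\ge t$) $$V^R_t(w,x)=\begin{cases}(N-t)w-x,& x\le 0,\\ \bar V^R_t(\max(w,x/A_t),x),& x>0,\ t<N,\\ 0,& x>0,\ t=N,\end{cases}$$ $$\bar V^R_t(w,x)=\mathbb E^{\mathbb Q}\big[V^R_{t+1}(w,\,xS_{t+1}/S_t-w)\,\big|\,S_t=s\big]\quad(t<N),$$ where the values may a priori also depend on the asset price $s=S_t$. Define backwards $\alpha_{N-1}=\beta_{N-1}=0$, $g^R_{N-1}(k)\,dk=\delta_1(dk)$ and, for $t\le N-2$, with $a=A_{t+1}$ and $b=1+A_{t+2}$, $$\alpha_t=\alpha_{t+1}\Big[1+\tfrac{C_{t+1}(b|a)}{A_{t+2}}\Big]+\beta_{t+1}P_{t+1}(b|a)+\int_1^{b}P_{t+1}(k|a)\,g^R_{t+1}(k)\,dk,$$ $$\beta_t=-\Big[\tfrac{\alpha_{t+1}}{A_{t+2}}\Delta^C_{t+1}(b|a)+\beta_{t+1}\Delta^P_{t+1}(b|a)+\int_1^{b}\Delta^P_{t+1}(k|a)\,g^R_{t+1}(k)\,dk\Big],$$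 $$g^R_t(k)=\Big(\tfrac{\alpha_{t+1}}{A_{t+2}}+\beta_{t+1}\Big)\Gamma_{t+1}(b|k-1)+\int_1^{b}\Gamma_{t+1}(k'|k-1)\,g^R_{t+1}(k')\,dk',\qquad k\in[1,1+A_{t+1}].$$ **Theorem.** The put and call values are differentiable in the spot $x>0$, and twice differentiable for almost every $x>0$. For $t\le N-2$ the function $g^R_t$ is integrable on $[1,1+A_{t+1}]$, and so are $k\mapsto P_t(wk|x)g^R_t(k)$ and $k\mapsto\Delta^P_t(wk|x)g^R_t(k)$ for all $w,x>0$, and $k\mapsto\Gamma_t(k|x)g^R_t(k)$ for almost every $x>0$. For every $t=0,\dots,N-1$: 1. For all $w,x,s>0$ the expectation defining $\bar V^R_t$ exists, does not depend on $s$, and $$\bar V^R_t(w,x)=\alpha_t\Big[w+\tfrac{C_t(w(1+A_{t+1})|x)}{A_{t+1}}\Big]+\beta_tP_t(w(1+A_{t+1})|x)+\int_1^{1+A_{t+1}}P_t(wk|x)\,g^R_t(k)\,dk;$$ for $t=N-1$ the right-hand side is $P_{N-1}(w|x)$. 2. $\bar V^R_t(cw,cx)=c\,\bar V^R_t(w,x)$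 for all $c,w,x>0$. 3. (Replication) For all $w>0$ and $y\ge 0$ the payoff at date $t+1$ of the portfolio in 1, at fund value $y$ before the withdrawal, equals $V^R_{t+1}(w,y-w)$: $$\alpha_t\Big[w+\tfrac{(y-w(1+A_{t+1}))^+}{A_{t+1}}\Big]+\beta_t(w(1+A_{t+1})-y)^++\int_1^{1+A_{t+1}}(wk-y)^+g^R_t(k)\,dk=V^R_{t+1}(w,y-w).$$ 4. The claims $Z^{(u)}$, $u\le N$, are integrable. Almost surely on $\{\tau>t\}$, $V_t$ equals the right-hand side of 1 at $(w_t,X_t)$, and $V_{t+1}$ equals the left-hand side of 3 at $w=w_t$, $y=X_{t+1}+w_t$; so the portfolio bought at $t$ for $V_t$ is worth exactly $V_{t+1}$ at $t+1$. -/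

import Mathlib

open MeasureTheory ProbabilityTheory Set

noncomputable section

namespace RollUp

/-! ### The asset price and its vanilla options -/

/-- The asset price `S`, observed at the withdrawal dates `0, …, N` (zero interest rates), is a
one-factor Markov process with transition kernels `κ`, prices are nonnegative, and the transition
laws are continuous: they have a density on `(0, ∞)`, an atom at `0` being allowed. -/
structure AssumptionA1 {Ω : Type*} {m : MeasurableSpace Ω} (Q : Measure Ω) (ℱ : Filtration ℕ m)
    (S : ℕ → Ω → ℝ) (κ : ℕ → Kernel ℝ ℝ) (N : ℕ) : Prop where
  nonneg : ∀ t < N, ∀ s, 0 ≤ s → κ t s (Iio 0) = 0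
  markov : ∀ t < N, ∀ B, MeasurableSet B →
    Q[(S (t + 1) ⁻¹' B).indicator (fun _ => (1 : ℝ)) | ℱ t] =ᵐ[Q]
      fun ω => (κ t (S t ω)).real B
  continuous : ∀ t < N, ∀ s, 0 < s → ((κ t s).restrict (Ioi 0)).AbsolutelyContinuous volume

/-- `P_t(K | x)`: value at date `t`, at spot `x`, of the put with strike `K` and maturity `t+1`. -/
def put (κ : ℕ → Kernel ℝ ℝ) (t : ℕ) (K x : ℝ) : ℝ := ∫ y, max (K - y) 0 ∂(κ t x)

/-- `C_t(K | x)`: value at date `t`, at spot `x`, of the call with strike `K` and maturity `t+1`. -/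
def call (κ : ℕ → Kernel ℝ ℝ) (t : ℕ) (K x : ℝ) : ℝ := ∫ y, max (y - K) 0 ∂(κ t x)

/-- Delta of the put: its first derivative in the spot. -/
def putDelta (κ : ℕ → Kernel ℝ ℝ) (t : ℕ) (K x : ℝ) : ℝ := deriv (fun z => put κ t K z) x

/-- Delta of the call. -/
def callDelta (κ : ℕ → Kernel ℝ ℝ) (t : ℕ) (K x : ℝ) : ℝ := deriv (fun z => call κ t K z) x

/-- Gamma of the put: its second derivative in the spot. -/
def gamma (κ : ℕ → Kernel ℝ ℝ) (t : ℕ) (K x : ℝ) : ℝ := deriv (fun z => putDelta κ t K z) x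

/-- The scaling property of the put values. -/
def AssumptionA2 (κ : ℕ → Kernel ℝ ℝ) (N : ℕ) : Prop :=
  ∀ t < N, ∀ a, 0 < a → ∀ K, 0 < K → ∀ s, 0 < s → put κ t (a * K) (a * s) = a * put κ t K s

/-! ### The fund, the guarantee claims and their value -/

/-- The pair `(X_t, w_t)` of fund value (after withdrawal) and guaranteed withdrawal level, with
`X_{t+1} = X_t S_{t+1} / S_t - w_t` and roll-up `w_{t+1} = max (w_t, X_{t+1} / A_{t+1})`, except
that there is no roll-up at maturity `N`. -/
def fundPair {Ω : Type*} (S : ℕ → Ω → ℝ) (A : ℕ → ℝ) (N : ℕ) (x₀ w₀ : ℝ) : ℕ → Ω → ℝ × ℝ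
  | 0, _ => (x₀, w₀)
  | t + 1, ω =>
    let p := fundPair S A N x₀ w₀ t ω
    let x := p.1 * (S (t + 1) ω / S t ω) - p.2
    (x, if t + 1 < N then max p.2 (x / A (t + 1)) else p.2)

/-- The fund value `X_t`. -/
def fund {Ω : Type*} (S : ℕ → Ω → ℝ) (A : ℕ → ℝ) (N : ℕ) (x₀ w₀ : ℝ) (t : ℕ) (ω : Ω) : ℝ :=
  (fundPair S A N x₀ w₀ t ω).1

/-- The guaranteed withdrawal level `w_t`. -/
def level {Ω : Type*} (S : ℕ → Ω → ℝ) (A : ℕ → ℝ) (N : ℕ) (x₀ w₀ : ℝ) (t : ℕ) (ω : Ω) : ℝ :=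
  (fundPair S A N x₀ w₀ t ω).2

/-- The depletion time `τ = inf {t ≤ N : X_t ≤ 0}`, with value `⊤` if there is no depletion. -/
def depletionTime {Ω : Type*} (S : ℕ → Ω → ℝ) (A : ℕ → ℝ) (N : ℕ) (x₀ w₀ : ℝ) (ω : Ω) : ℕ∞ :=
  sInf ((fun u : ℕ => (u : ℕ∞)) '' {u : ℕ | u ≤ N ∧ fund S A N x₀ w₀ u ω ≤ 0})

open Classical in
/-- The claim `Z^{(t)}` that the guarantor pays at date `t`:
`Z^{(0)} = 0` and `Z^{(t)} = w_{t-1} 1_{τ ≤ t-1} + X_t⁻ 1_{τ = t}` for `t ≥ 1`. -/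
def claim {Ω : Type*} (S : ℕ → Ω → ℝ) (A : ℕ → ℝ) (N : ℕ) (x₀ w₀ : ℝ) : ℕ → Ω → ℝ
  | 0, _ => 0
  | t + 1, ω =>
    (if depletionTime S A N x₀ w₀ ω ≤ (t : ℕ∞) then level S A N x₀ w₀ t ω else 0) +
    (if depletionTime S A N x₀ w₀ ω = ((t + 1 : ℕ) : ℕ∞)
      then -min 0 (fund S A N x₀ w₀ (t + 1) ω) else 0)

/-- The market value process `V_t = E_t[∑_{u = t}^N Z^{(u)}]` of the guarantee with roll-up. -/
def valueProcess {Ω : Type*} {m : MeasurableSpace Ω} (Q : Measure Ω) (ℱ : Filtration ℕ m)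
    (S : ℕ → Ω → ℝ) (A : ℕ → ℝ) (N : ℕ) (x₀ w₀ : ℝ) (t : ℕ) : Ω → ℝ :=
  Q[fun ω => ∑ u ∈ Finset.Icc t N, claim S A N x₀ w₀ u ω | ℱ t]

/-- The value function `V^R_t(w, x)` of the guarantee at date `t`, for previous withdrawal level
`w = w_{t-1}` and fund value `x = X_t` when the fund was not depleted before `t`. If `x ≤ 0` (the
fund depletes at `t`) it is `(N - t) w - x`; if `x > 0` it is, for `t < N`, the expected value one
period later with the rolled-up level, and `0` at maturity. A priori it may depend on the asset
price `s = S_t` as well. -/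
def valueFun (κ : ℕ → Kernel ℝ ℝ) (A : ℕ → ℝ) (N : ℕ) (t : ℕ) (w x s : ℝ) : ℝ :=
  if x ≤ 0 then ((N : ℝ) - t) * w - x
  else if _h : t < N then
    ∫ y, valueFun κ A N (t + 1) (max w (x / A t)) (x * (y / s) - max w (x / A t)) y ∂(κ t s)
  else 0
termination_by N - t

/-- `V̄^R_t(w, x) = E[V^R_{t+1}(w, X_{t+1}) | X_t = x, S_t = s]` for the current withdrawal level
`w = w_t`, where `X_{t+1} = x S_{t+1} / s - w`. -/
def valueBar (κ : ℕ → Kernel ℝ ℝ) (A : ℕ → ℝ) (N : ℕ) (t : ℕ) (w x s : ℝ) : ℝ :=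
  ∫ y, valueFun κ A N (t + 1) w (x * (y / s) - w) y ∂(κ t s)

/-! ### The hedge portfolio -/

/-- The coefficients of the hedge: the constants `α`, `β`, and the weight
`dirac • δ₁ + g(k) dk` on the put strikes. -/
structure Weights where
  α : ℝ
  β : ℝ
  dirac : ℝ
  g : ℝ → ℝ

/-- The integral over `[1, b]` of `f` against the weight `dirac • δ₁ + g(k) dk`. -/
def Weights.integrate (W : Weights) (b : ℝ) (f : ℝ → ℝ) : ℝ :=
  W.dirac * f 1 + ∫ k in Icc 1 b, f k * W.g k

/-- The backward recursion for the coefficients. At date `N - 1` they are `α = β = 0` and the Dirac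
weight `δ₁`; as `α = β = 0` and `g = 0` there, the value `A N` (formally `∞`) plays no role. -/
def weights (κ : ℕ → Kernel ℝ ℝ) (A : ℕ → ℝ) (N : ℕ) (t : ℕ) : Weights :=
  if _h : t + 1 < N then
    let W := weights κ A N (t + 1)
    let a := A (t + 1)
    let b := 1 + A (t + 2)
    { α := W.α * (1 + 1 / A (t + 2) * call κ (t + 1) b a) + W.β * put κ (t + 1) b a
        + W.integrate b (fun k => put κ (t + 1) k a)
      β := -(W.α / A (t + 2) * callDelta κ (t + 1) b a + W.β * putDelta κ (t + 1) b a
        + W.integrate b (fun k => putDelta κ (t + 1) k a))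
      dirac := 0
      g := fun k => (W.α / A (t + 2) + W.β) * gamma κ (t + 1) b (k - 1)
        + W.integrate b (fun k' => gamma κ (t + 1) k' (k - 1)) }
  else { α := 0, β := 0, dirac := 1, g := fun _ => 0 }
termination_by N - t

/-- Value at date `t` of the portfolio set up at `t`, at withdrawal level `w` and fund value `x`:
`α_t [w + C_t(w(1+A_{t+1})|x) / A_{t+1}] + β_t P_t(w(1+A_{t+1})|x)
  + ∫_{[1, 1+A_{t+1}]} P_t(wk|x) g_t(k) dk`. -/
def hedgeValue (κ : ℕ → Kernel ℝ ℝ) (A : ℕ → ℝ) (N : ℕ) (t : ℕ) (w x : ℝ) : ℝ :=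
  let W := weights κ A N t
  let b := 1 + A (t + 1)
  W.α * (w + 1 / A (t + 1) * call κ t (w * b) x) + W.β * put κ t (w * b) x
    + W.integrate b (fun k => put κ t (w * k) x)

/-- Payoff at date `t + 1` of the same portfolio, if the fund is worth `y` before the withdrawal
at `t + 1`: every put and call is replaced by its payoff. -/
def hedgePayoff (κ : ℕ → Kernel ℝ ℝ) (A : ℕ → ℝ) (N : ℕ) (t : ℕ) (w y : ℝ) : ℝ :=
  let W := weights κ A N t
  let b := 1 + A (t + 1)
  W.α * (w + 1 / A (t + 1) * max (y - w * b) 0) + W.β * max (w * b - y) 0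
    + W.integrate b (fun k => max (w * k - y) 0)

end RollUp

end

/-! The transitions are multiplicative. By (A2) the puts at spot `s` are those of `s` times a return
`R` with law `κ t 1`. Put values determine a law on `[0, ∞)` (`measure_eq_of_put_eq`), so `κ t s` is
the law of `s R`, and the martingale property forces `E R = 1` (`AssumptionA1.isScaling`).
Everything is then explicit in `M(u) = E[R; R ≤ u]`: the put Delta is `-M(K/x)`, the Gamma is `K/x²
M'(K/x)`, and `M'(r)` is almost everywhere `r` times the density of `R`.

The hedge is a Taylor expansion at `a`: for `x ≤ a`, `f(x) = f(a) - (a - x) f'(a) + ∫_0^a (z - x)^+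
f''(z) dz`, whose remainder is a mixture of put payoffs. For `f = P(K|·)` it needs no smoothness of
Gamma: under `z = K/R` the measure `Γ(K|z) dz` is the image of `R dρ` on `R > 0`, and `R (K/R - x)^+
= (K - xR)^+` (`IsReturnLaw.integral_pos_part_mul_returnGamma`). Mixtures follow by Fubini.

By homogeneity take level 1; let `a = A (t+1)` and let `x` be the fund after the withdrawal at
`t+1`. Without roll-up (`0 < x ≤ a`) the target is `f(x)`, the value of the next portfolio at level
1; by put-call parity `f` is affine plus a mixture of puts. With roll-up (`x > a`) the target is
`(x/a) f(a)`. The recursion reads `α = f(a)`, `β = -f'(a)`, `g(z+1) = f''(z)`. So below `a` the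
payoff is the expansion of `f` (`hedgePayoff_one_add_one`), while above `a` all puts expire
worthless and the remaining term is `α x/a`. The expansion persists for `x ≤ 0`, where `P(k|x) = k -
x`; there it reduces the payoff at `t` to that at `t+1`, and induction gives the depletion value
(`hedgePayoff_one_of_le_one`).

The payoff integrates to the portfolio value (`integral_hedgePayoff`), so backward induction
identifies the value function. For the value process, the claims from a depletion date on are known
at that date, and on surviving paths the conditional expectation is the same kernel integral. -/

namespace RollUp

/-! ### Laws of one-period returns -/

/-- The law of a nonnegative one-period return with mean one and no atoms on `(0, ∞)`, in fact with
a density there. -/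
structure IsReturnLaw (ρ : Measure ℝ) : Prop where
  prob : IsProbabilityMeasure ρ
  nonneg : ∀ᵐ r ∂ρ, 0 ≤ r
  integrable : Integrable (fun r => r) ρ
  mean : ∫ r, r ∂ρ = 1
  ac : (ρ.restrict (Ioi 0)).AbsolutelyContinuous volume

/-- The value of a put with strike `K` on `x` times the return. -/
noncomputable def returnPut (ρ : Measure ℝ) (K x : ℝ) : ℝ := ∫ r, max (K - x * r) 0 ∂ρ

/-- The partial mean `E[R; R ≤ u]` of the return. -/
noncomputable def partialMean (ρ : Measure ℝ) (u : ℝ) : ℝ := ∫ r in Iic u, r ∂ρ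

/-- The second derivative in `x` of `returnPut ρ K x`. -/
noncomputable def returnGamma (ρ : Measure ℝ) (K x : ℝ) : ℝ :=
  K / x ^ 2 * deriv (partialMean ρ) (K / x)

variable {ρ : Measure ℝ}

namespace IsReturnLaw

theorem partialMean_mono (h : IsReturnLaw ρ) : Monotone (partialMean ρ) := fun _ _ huv =>
  setIntegral_mono_set h.integrable.integrableOn (ae_restrict_of_ae h.nonneg)
    (Iic_subset_Iic.2 huv).eventuallyLE

theorem partialMean_nonneg (h : IsReturnLaw ρ) (u : ℝ) : 0 ≤ partialMean ρ u :=
  integral_nonneg_of_ae (ae_restrict_of_ae h.nonneg)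

theorem partialMean_le_one (h : IsReturnLaw ρ) (u : ℝ) : partialMean ρ u ≤ 1 :=
  (setIntegral_le_integral h.integrable h.nonneg).trans_eq h.mean

theorem deriv_partialMean_nonneg (h : IsReturnLaw ρ) (u : ℝ) : 0 ≤ deriv (partialMean ρ) u :=
  h.partialMean_mono.deriv_nonneg

/-- The weight `r` kills a possible atom at `0`; this is why that atom never enters the Gammas. -/
theorem setIntegral_Ioi_mul (h : IsReturnLaw ρ) (φ : ℝ → ℝ) :
    ∫ r in Ioi 0, φ r * r ∂ρ = ∫ r, φ r * r ∂ρ := by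
  refine setIntegral_eq_integral_of_ae_compl_eq_zero ?_
  filter_upwards [h.nonneg] with r hr hr'
  rw [le_antisymm (not_lt.1 hr') hr, mul_zero]

theorem measure_singleton (h : IsReturnLaw ρ) {u : ℝ} (hu : 0 < u) : ρ {u} = 0 := by
  have h1 := h.ac (show volume {u} = 0 by simp)
  rwa [Measure.restrict_apply (measurableSet_singleton u),
    inter_eq_left.2 (singleton_subset_iff.2 (mem_Ioi.2 hu))] at h1

/-- Lebesgue differentiation: `partialMean ρ` is a primitive of `r` times the density on `(0, ∞)`.
-/
theorem deriv_partialMean_ae (h : IsReturnLaw ρ) : deriv (partialMean ρ) =ᵐ[volume]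
    fun r => ((ρ.restrict (Ioi 0)).rnDeriv volume r).toReal • r := by
  have := h.prob
  set q : ℝ → ℝ := fun r => ((ρ.restrict (Ioi 0)).rnDeriv volume r).toReal • r
  have hq : Integrable q := (integrable_rnDeriv_smul_iff h.ac).2 h.integrable.restrict
  have hM : partialMean ρ = fun u => ∫ r in Iic u, q r := by
    ext u
    have h1 : ∫ r, ((ρ.restrict (Ioi 0)).rnDeriv volume r).toReal •
        (Iic u).indicator (fun r => r) r = ∫ r in Ioi 0, (Iic u).indicator (fun r => r) r ∂ρ :=
      integral_rnDeriv_smul h.ac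
    rw [partialMean, ← integral_indicator measurableSet_Iic, ← integral_indicator measurableSet_Iic]
    have h2 := h.setIntegral_Ioi_mul ((Iic u).indicator 1)
    calc _ = ∫ r, (Iic u).indicator 1 r * r ∂ρ := by
          refine integral_congr_ae (.of_forall fun r => ?_)
          by_cases hr : r ∈ Iic u <;> simp [hr]
      _ = _ := by
          rw [← h2]
          refine Eq.trans ?_ (h1.symm.trans ?_)
          · refine integral_congr_ae (.of_forall fun r => ?_)
            by_cases hr : r ∈ Iic u <;> simp [hr]
          · refine integral_congr_ae (.of_forall fun r => ?_)
            by_cases hr : r ∈ Iic u <;> simp [hr, q]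
  filter_upwards [LocallyIntegrable.ae_hasDerivAt_integral hq.locallyIntegrable] with u hu
  have h3 : partialMean ρ = fun v => (∫ r in Iic 0, q r) + ∫ r in (0 : ℝ)..v, q r := by
    rw [hM]
    ext v
    rw [← intervalIntegral.integral_Iic_sub_Iic hq.integrableOn hq.integrableOn]
    ring
  rw [h3]
  exact ((hu 0).const_add _).deriv

theorem integrable_mul_deriv_partialMean (h : IsReturnLaw ρ) {φ : ℝ → ℝ}
    (hφ : Integrable (fun r => φ r * r) ρ) :
    Integrable (fun u => φ u * deriv (partialMean ρ) u) := by
  have := h.prob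
  refine ((integrable_rnDeriv_smul_iff h.ac).2 hφ.restrict).congr ?_
  filter_upwards [h.deriv_partialMean_ae] with u hu
  rw [hu, smul_eq_mul, smul_eq_mul]
  ring

theorem integral_mul_deriv_partialMean (h : IsReturnLaw ρ) (φ : ℝ → ℝ) :
    ∫ u, φ u * deriv (partialMean ρ) u = ∫ r, φ r * r ∂ρ := by
  have := h.prob
  rw [← h.setIntegral_Ioi_mul, ← integral_rnDeriv_smul h.ac]
  refine integral_congr_ae ?_
  filter_upwards [h.deriv_partialMean_ae] with u hu
  rw [hu, smul_eq_mul, smul_eq_mul]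
  ring

end IsReturnLaw

/-! ### Change of variables `z = K / r`: integrals against Gamma. -/

theorem image_const_div_Ioi {K : ℝ} (hK : 0 < K) : (fun z => K / z) '' Ioi 0 = Ioi 0 := by
  ext u
  simp only [mem_image, mem_Ioi]
  exact ⟨fun ⟨z, hz, hu⟩ => hu ▸ div_pos hK hz, fun hu => ⟨K / u, div_pos hK hu, by field_simp⟩⟩

theorem hasDerivWithinAt_const_div {K z : ℝ} (hz : z ∈ Ioi 0) :
    HasDerivWithinAt (fun z => K / z) (-(K / z ^ 2)) (Ioi 0) z := by
  have h1 := ((hasDerivAt_inv (ne_of_gt hz)).const_mul K).hasDerivWithinAt (s := Ioi 0)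
  exact h1.congr_deriv (by ring)

theorem injOn_const_div {K : ℝ} (hK : 0 < K) : InjOn (fun z => K / z) (Ioi 0) := by
  intro y hy z hz hyz
  have hy : y ≠ 0 := ne_of_gt hy
  have hz : z ≠ 0 := ne_of_gt hz
  have : K ≠ 0 := hK.ne'
  simp only at hyz
  field_simp at hyz
  exact hyz.symm

theorem abs_deriv_smul_eq {K z : ℝ} (hK : 0 < K) (hz : z ∈ Ioi 0) (ψ : ℝ → ℝ) :
    |-(K / z ^ 2)| • (ψ (K / (K / z)) * deriv (partialMean ρ) (K / z)) =
      ψ z * returnGamma ρ K z := by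
  have hz : 0 < z := hz
  rw [abs_neg, abs_of_pos (by positivity), smul_eq_mul, returnGamma, div_div_cancel₀ hK.ne']
  ring

namespace IsReturnLaw

theorem integrableOn_mul_returnGamma (h : IsReturnLaw ρ) {K : ℝ} (hK : 0 < K) {ψ : ℝ → ℝ}
    (hψ : Integrable (fun r => ψ (K / r) * r) ρ) :
    IntegrableOn (fun z => ψ z * returnGamma ρ K z) (Ioi 0) := by
  have h1 := (h.integrable_mul_deriv_partialMean (φ := fun r => ψ (K / r)) hψ).integrableOn
    (s := Ioi 0)
  rw [← image_const_div_Ioi hK, integrableOn_image_iff_integrableOn_abs_deriv_smul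
    measurableSet_Ioi (fun z hz => hasDerivWithinAt_const_div hz) (injOn_const_div hK)] at h1
  exact h1.congr_fun (fun z hz => abs_deriv_smul_eq hK hz ψ) measurableSet_Ioi

/-- The Jacobian `K / z ^ 2` is exactly the prefactor of `returnGamma`, so substituting `u = K / z`
leaves an integral against `M'(u) du`, that is, against `r dρ`. -/
theorem integral_mul_returnGamma (h : IsReturnLaw ρ) {K : ℝ} (hK : 0 < K) (ψ : ℝ → ℝ) :
    ∫ z in Ioi 0, ψ z * returnGamma ρ K z = ∫ r in Ioi 0, ψ (K / r) * r ∂ρ := by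
  have h1 := h.integral_mul_deriv_partialMean ((Ioi 0).indicator fun r => ψ (K / r))
  calc _ = ∫ u in Ioi 0, ψ (K / u) * deriv (partialMean ρ) u := by
        conv_rhs => rw [← image_const_div_Ioi hK]
        rw [integral_image_eq_integral_abs_deriv_smul
          measurableSet_Ioi (fun z hz => hasDerivWithinAt_const_div hz) (injOn_const_div hK)]
        exact setIntegral_congr_fun measurableSet_Ioi
          fun z hz => (abs_deriv_smul_eq hK hz ψ).symm
    _ = _ := by
        rw [← integral_indicator measurableSet_Ioi, ← integral_indicator measurableSet_Ioi]
        refine Eq.trans ?_ (h1.trans ?_) <;>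
        · refine integral_congr_ae (.of_forall fun r => ?_)
          by_cases hr : r ∈ Ioi 0
          · simp only [indicator_of_mem hr]
          · simp only [indicator_of_notMem hr, zero_mul]

theorem returnGamma_nonneg (h : IsReturnLaw ρ) {K : ℝ} (hK : 0 ≤ K) (z : ℝ) :
    0 ≤ returnGamma ρ K z :=
  mul_nonneg (by positivity) (h.deriv_partialMean_nonneg _)

theorem integrableOn_returnGamma (h : IsReturnLaw ρ) {K : ℝ} (hK : 0 < K) :
    IntegrableOn (returnGamma ρ K) (Ioi 0) := by
  have h1 := h.integrableOn_mul_returnGamma hK (ψ := fun _ => 1) (by simpa using h.integrable)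
  simpa using h1

theorem integral_returnGamma (h : IsReturnLaw ρ) {K : ℝ} (hK : 0 < K) :
    ∫ z in Ioi 0, returnGamma ρ K z = 1 := by
  have h1 := h.integral_mul_returnGamma hK (fun _ => 1)
  rw [h.setIntegral_Ioi_mul (fun _ => 1)] at h1
  simpa [h.mean] using h1

/-! ### Put values as functions of spot and strike. -/

theorem integrable_put_payoff (h : IsReturnLaw ρ) (K x : ℝ) :
    Integrable (fun r => max (K - x * r) 0) ρ := by
  have := h.prob
  exact ((integrable_const K).sub (h.integrable.const_mul x)).pos_part

/-- A put on a nonpositive spot is always in the money. This extension of the put price describes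
the depleted fund. -/
theorem returnPut_of_nonpos (h : IsReturnLaw ρ) {K x : ℝ} (hK : 0 ≤ K) (hx : x ≤ 0) :
    returnPut ρ K x = K - x := by
  have := h.prob
  have h1 : returnPut ρ K x = ∫ r, (K - x * r) ∂ρ := by
    refine integral_congr_ae ?_
    filter_upwards [h.nonneg] with r hr
    exact max_eq_left (by nlinarith [mul_nonneg (neg_nonneg.2 hx) hr])
  rw [h1, integral_sub (integrable_const K) (h.integrable.const_mul x), integral_const_mul, h.mean]
  simp

theorem lipschitz_returnPut (h : IsReturnLaw ρ) (x : ℝ) :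
    LipschitzWith 1 (fun K => returnPut ρ K x) := by
  have := h.prob
  refine LipschitzWith.of_dist_le_mul fun K L => ?_
  rw [Real.dist_eq, Real.dist_eq, returnPut, returnPut,
    ← integral_sub (h.integrable_put_payoff K x) (h.integrable_put_payoff L x)]
  have hb : ∀ᵐ r ∂ρ, ‖max (K - x * r) 0 - max (L - x * r) 0‖ ≤ |K - L| :=
    .of_forall fun r => (abs_max_sub_max_le_abs _ _ _).trans_eq (by ring_nf)
  refine (norm_integral_le_of_norm_le_const hb).trans ?_
  simp

/-- A put is replicated by its gamma on `(0, a)` together with its value and delta at `a`. -/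
theorem integral_pos_part_mul_returnGamma (h : IsReturnLaw ρ) {K a x : ℝ} (hK : 0 < K) (ha : 0 < a)
    (hx : x ≤ a) :
    ∫ z in Ioi 0, (Iio a).indicator (fun z => max (z - x) 0) z * returnGamma ρ K z =
      returnPut ρ K x - returnPut ρ K a - (a - x) * partialMean ρ (K / a) := by
  have hi : Integrable ((Iic (K / a)).indicator fun r => r) ρ :=
    h.integrable.indicator measurableSet_Iic
  have hp : Integrable (fun r => max (K - x * r) 0 - max (K - a * r) 0) ρ :=
    (h.integrable_put_payoff K x).sub (h.integrable_put_payoff K a)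
  rw [h.integral_mul_returnGamma hK, partialMean, ← integral_indicator measurableSet_Iic, returnPut,
    returnPut, ← integral_sub (h.integrable_put_payoff K x) (h.integrable_put_payoff K a),
    ← integral_const_mul, ← integral_sub hp (hi.const_mul _), ← integral_indicator measurableSet_Ioi]
  refine integral_congr_ae ?_
  filter_upwards [h.nonneg] with r hr
  rcases hr.eq_or_lt with rfl | hr
  · have : (0 : ℝ) ∈ Iic (K / a) := (div_pos hK ha).le
    simp
  · rw [indicator_of_mem (show r ∈ Ioi 0 from hr)]
    -- The point `z = K / r` lies below `a` exactly when the put at spot `a` expires worthless.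
    -- Otherwise both puts are in the money, and their difference is `(a - x) r`.
    by_cases hra : r ≤ K / a
    · have h1 : K / r ∉ Iio a := by
        rw [mem_Iio, not_lt, le_div_iff₀ hr]
        rwa [le_div_iff₀ ha, mul_comm] at hra
      rw [le_div_iff₀ ha] at hra
      have h2 : r ∈ Iic (K / a) := (le_div_iff₀ ha).2 hra
      rw [indicator_of_notMem h1, indicator_of_mem h2, max_eq_left (by nlinarith),
        max_eq_left (by nlinarith)]
      ring
    · have h2 : r ∉ Iic (K / a) := hra
      rw [not_le, div_lt_iff₀ ha] at hra
      have h1 : K / r ∈ Iio a := by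
        rw [mem_Iio, div_lt_iff₀ hr]
        linarith
      rw [indicator_of_mem h1, indicator_of_notMem h2, max_eq_right (b := 0) (a := K - a * r)
        (by linarith), max_mul_of_nonneg _ _ hr.le]
      field_simp
      simp

theorem hasDerivAt_returnPut (h : IsReturnLaw ρ) {K x : ℝ} (hK : 0 < K) (hx : 0 < x) :
    HasDerivAt (returnPut ρ K) (-partialMean ρ (K / x)) x := by
  have := h.prob
  have h1 := hasDerivAt_integral_of_dominated_loc_of_lip (𝕜 := ℝ) (μ := ρ)
    (F := fun x r => max (K - x * r) 0)
    (F' := fun r => -(Iic (K / x)).indicator (fun r => r) r) (x₀ := x) (bound := fun r => r)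
    (s := univ) Filter.univ_mem
    (.of_forall fun y => (h.integrable_put_payoff K y).aestronglyMeasurable)
    (h.integrable_put_payoff K x)
    (h.integrable.indicator measurableSet_Iic).neg.aestronglyMeasurable ?_ h.integrable ?_
  · have h2 := h1.2
    rwa [integral_neg, integral_indicator measurableSet_Iic] at h2
  · refine .of_forall fun r => LipschitzOnWith.of_dist_le_mul fun y _ z _ => ?_
    rw [Real.dist_eq, Real.dist_eq]
    refine (abs_max_sub_max_le_abs _ _ _).trans_eq ?_
    rw [Real.coe_nnabs, ← abs_mul, abs_sub_comm]
    ring_nf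
  -- The payoff has its only kink, as a function of the spot near `x`, when `r = K / x`; the return
  -- law has no atom there.
  · have h2 : ∀ᵐ r ∂ρ, r ≠ K / x := by
      rw [ae_iff]
      simpa using h.measure_singleton (div_pos hK hx)
    filter_upwards [h2] with r hr
    have h3 : HasDerivAt (fun y => K - y * r) (-r) x := by
      simpa using ((hasDerivAt_id x).mul_const r).const_sub K
    have hc : Continuous fun y => K - y * r := by fun_prop
    rcases lt_or_gt_of_ne hr with hr | hr
    · rw [indicator_of_mem (show r ∈ Iic (K / x) from hr.le)]
      refine h3.congr_of_eventuallyEq ?_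
      rw [lt_div_iff₀ hx] at hr
      filter_upwards [hc.continuousAt.eventually (lt_mem_nhds (show 0 < K - x * r by linarith))]
        with y hy
      exact max_eq_left hy.le
    · rw [indicator_of_notMem (show r ∉ Iic (K / x) from not_le.2 hr), neg_zero]
      refine (hasDerivAt_const x (0 : ℝ)).congr_of_eventuallyEq ?_
      replace hr := (div_lt_iff₀ hx).1 hr
      filter_upwards [hc.continuousAt.eventually (gt_mem_nhds (show K - x * r < 0 by linarith))]
        with y hy
      exact max_eq_right hy.le

end IsReturnLaw

/-- Valid at every `x > 0`, not only almost everywhere: `z ↦ K / z` is a smooth involution of `(0,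
∞)`, so both derivatives fail to exist together, and then both sides have the default value `0`. -/
theorem deriv_neg_partialMean_const_div (ρ : Measure ℝ) {K x : ℝ} (hK : 0 < K) (hx : 0 < x) :
    deriv (fun z => -partialMean ρ (K / z)) x = returnGamma ρ K x := by
  have hd : HasDerivAt (fun z => K / z) (-(K / x ^ 2)) x :=
    (hasDerivWithinAt_const_div hx).hasDerivAt (Ioi_mem_nhds hx)
  by_cases hM : DifferentiableAt ℝ (partialMean ρ) (K / x)
  · have h1 := (hM.hasDerivAt.comp x hd).neg
    refine h1.deriv.trans ?_
    rw [returnGamma]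
    ring
  · rw [returnGamma, deriv_zero_of_not_differentiableAt hM, mul_zero]
    refine deriv_zero_of_not_differentiableAt fun h1 => hM ?_
    have hx' : K / (K / x) = x := div_div_cancel₀ hK.ne'
    have hd' : DifferentiableAt ℝ (fun z => K / z) (K / x) :=
      ((hasDerivWithinAt_const_div (div_pos hK hx)).hasDerivAt
        (Ioi_mem_nhds (div_pos hK hx))).differentiableAt
    have h2 := (DifferentiableAt.comp (K / x) (by rwa [hx']) hd').neg
    refine h2.congr_of_eventuallyEq ?_
    filter_upwards [Ioi_mem_nhds (div_pos hK hx)] with z hz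
    simp [div_div_cancel₀ hK.ne']

theorem measurable_returnGamma (ρ : Measure ℝ) :
    Measurable (fun p : ℝ × ℝ => returnGamma ρ p.1 p.2) := by
  have := measurable_deriv (partialMean ρ)
  unfold returnGamma
  fun_prop

theorem IsReturnLaw.ae_differentiableAt (h : IsReturnLaw ρ) {K : ℝ} (hK : 0 < K) :
    ∀ᵐ x ∂(volume.restrict (Ioi (0 : ℝ))),
      DifferentiableAt ℝ (fun z => -partialMean ρ (K / z)) x := by
  have h1 : MonotoneOn (fun z => -partialMean ρ (K / z)) (Ioi 0) := fun y hy z hz hyz =>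
    neg_le_neg (h.partialMean_mono (div_le_div_of_nonneg_left hK.le hy hyz))
  filter_upwards [h1.ae_differentiableWithinAt measurableSet_Ioi,
    ae_restrict_mem measurableSet_Ioi] with x hx hx0
  exact hx.differentiableAt (Ioi_mem_nhds hx0)

/-! ### Weights on put strikes -/

/-- The integral of `f` against the weights, with an additional point mass `c` at `b`. -/
noncomputable def Weights.netIntegrate (W : Weights) (c b : ℝ) (f : ℝ → ℝ) : ℝ :=
  c * f b + W.integrate b f

namespace Weights

variable {W : Weights} {b c : ℝ} {f f' : ℝ → ℝ}

theorem integrableOn_continuous_mul (hg : IntegrableOn W.g (Icc 1 b)) (hf : Continuous f) :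
    IntegrableOn (fun k => f k * W.g k) (Icc 1 b) :=
  hg.continuousOn_mul hf.continuousOn isCompact_Icc

theorem integrate_congr (hff : ∀ k, 1 ≤ k → f k = f' k) : W.integrate b f = W.integrate b f' := by
  rw [integrate, integrate, hff 1 le_rfl]
  congr 1
  exact setIntegral_congr_fun measurableSet_Icc fun k hk => by simp only [hff k hk.1]

theorem netIntegrate_congr (hb : 1 ≤ b ∨ c = 0) (hff : ∀ k, 1 ≤ k → f k = f' k) :
    W.netIntegrate c b f = W.netIntegrate c b f' := by
  rw [netIntegrate, netIntegrate, integrate_congr hff]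
  rcases hb with hb | rfl
  · rw [hff b hb]
  · simp

theorem integrate_const_mul (W : Weights) (b r : ℝ) (f : ℝ → ℝ) :
    W.integrate b (fun k => r * f k) = r * W.integrate b f := by
  simp only [integrate, mul_assoc, integral_const_mul]
  ring

theorem netIntegrate_sub (hf : IntegrableOn (fun k => f k * W.g k) (Icc 1 b))
    (hf' : IntegrableOn (fun k => f' k * W.g k) (Icc 1 b)) :
    W.netIntegrate c b (fun k => f k - f' k) = W.netIntegrate c b f - W.netIntegrate c b f' := by
  simp only [netIntegrate, integrate, sub_mul]
  rw [integral_sub hf hf']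
  ring

theorem netIntegrate_const_mul (W : Weights) (c b r : ℝ) (f : ℝ → ℝ) :
    W.netIntegrate c b (fun k => r * f k) = r * W.netIntegrate c b f := by
  rw [netIntegrate, netIntegrate, integrate_const_mul]
  ring

theorem integrableOn_partialMean_mul {ρ : Measure ℝ} (h : IsReturnLaw ρ)
    (hg : IntegrableOn W.g (Icc 1 b)) {w x : ℝ} :
    IntegrableOn (fun k => partialMean ρ (w * k / x) * W.g k) (Icc 1 b) := by
  refine hg.bdd_mul (c := 1) ?_ (.of_forall fun k => ?_)
  · have := h.partialMean_mono.measurable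
    exact (this.comp (by fun_prop)).aestronglyMeasurable
  · rw [Real.norm_of_nonneg (h.partialMean_nonneg _)]
    exact h.partialMean_le_one _

/-- Tonelli: each Gamma is nonnegative with integral one in the spot, so the `L¹` norm over strike
and spot is that of `g`. -/
theorem integrable_returnGamma_mul {ρ : Measure ℝ} (h : IsReturnLaw ρ)
    (hg : IntegrableOn W.g (Icc 1 b)) :
    Integrable (fun p : ℝ × ℝ => returnGamma ρ p.1 p.2 * W.g p.1)
      ((volume.restrict (Icc 1 b)).prod (volume.restrict (Ioi 0))) := by
  refine (integrable_prod_iff ?_).2 ⟨?_, ?_⟩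
  · exact (measurable_returnGamma ρ).aestronglyMeasurable.mul hg.aestronglyMeasurable.comp_fst
  · filter_upwards [ae_restrict_mem measurableSet_Icc] with k hk
    exact (h.integrableOn_returnGamma (one_pos.trans_le hk.1)).mul_const _
  · refine hg.norm.congr ?_
    filter_upwards [ae_restrict_mem measurableSet_Icc] with k hk
    have hk0 : (0 : ℝ) < k := one_pos.trans_le hk.1
    simp only [norm_mul, integral_mul_const]
    simp_rw [Real.norm_of_nonneg (h.returnGamma_nonneg hk0.le _)]
    rw [h.integral_returnGamma hk0, one_mul]

theorem integrableOn_netIntegrate_returnGamma {ρ : Measure ℝ} (h : IsReturnLaw ρ)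
    (hg : IntegrableOn W.g (Icc 1 b)) (hb : 1 ≤ b ∨ c = 0) :
    IntegrableOn (fun z => W.netIntegrate c b (fun k => returnGamma ρ k z)) (Ioi 0) := by
  refine Integrable.add ?_ (((h.integrableOn_returnGamma one_pos).const_mul _).add
    (integrable_returnGamma_mul h hg).integral_prod_right)
  rcases hb with hb | rfl
  · exact (h.integrableOn_returnGamma (one_pos.trans_le hb)).const_mul _
  · simp

/-- Fubini for a bounded test function, with the two point masses treated separately from `g`. -/
theorem integral_mul_netIntegrate_returnGamma {ρ : Measure ℝ} (h : IsReturnLaw ρ)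
    (hg : IntegrableOn W.g (Icc 1 b)) (hb : 1 ≤ b ∨ c = 0) {ψ : ℝ → ℝ} (hψ : Measurable ψ) {C : ℝ}
    (hC : ∀ z, 0 < z → |ψ z| ≤ C) :
    ∫ z in Ioi 0, ψ z * W.netIntegrate c b (fun k => returnGamma ρ k z) =
      W.netIntegrate c b (fun k => ∫ z in Ioi 0, ψ z * returnGamma ρ k z) := by
  have hC' : ∀ᵐ z ∂(volume.restrict (Ioi (0 : ℝ))), ‖ψ z‖ ≤ C := by
    filter_upwards [ae_restrict_mem measurableSet_Ioi] with z hz using hC z hz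
  have h1 : ∀ k, 0 < k → IntegrableOn (fun z => ψ z * returnGamma ρ k z) (Ioi 0) := fun k hk =>
    (h.integrableOn_returnGamma hk).bdd_mul hψ.aestronglyMeasurable hC'
  have h2 : Integrable (fun p : ℝ × ℝ => ψ p.2 * (returnGamma ρ p.1 p.2 * W.g p.1))
      ((volume.restrict (Icc 1 b)).prod (volume.restrict (Ioi 0))) := by
    refine (integrable_returnGamma_mul h hg).bdd_mul (c := C)
      (hψ.comp measurable_snd).aestronglyMeasurable ?_
    exact Measure.quasiMeasurePreserving_snd.ae hC'
  have h3 := integral_integral_swap (f := fun k z => ψ z * (returnGamma ρ k z * W.g k)) h2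
  have h4 : IntegrableOn (fun z => c * (ψ z * returnGamma ρ b z)) (Ioi 0) := by
    rcases hb with hb | rfl
    · exact (h1 b (one_pos.trans_le hb)).const_mul c
    · simp
  have h5 := (h1 1 one_pos).const_mul W.dirac
  have h6 : IntegrableOn (fun z => ∫ k in Icc 1 b, ψ z * (returnGamma ρ k z * W.g k)) (Ioi 0) :=
    h2.integral_prod_right
  have h7 : IntegrableOn (fun z => W.dirac * (ψ z * returnGamma ρ 1 z)
      + ∫ k in Icc 1 b, ψ z * (returnGamma ρ k z * W.g k)) (Ioi 0) := h5.add h6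
  calc _ = ∫ z in Ioi 0, (c * (ψ z * returnGamma ρ b z) + (W.dirac * (ψ z * returnGamma ρ 1 z)
        + ∫ k in Icc 1 b, ψ z * (returnGamma ρ k z * W.g k))) := by
        refine integral_congr_ae (.of_forall fun z => ?_)
        simp only [netIntegrate, integrate, integral_const_mul]
        ring
    _ = _ := by
        rw [integral_add h4 h7, integral_add h5 h6, integral_const_mul, integral_const_mul,
          netIntegrate, integrate, ← h3]
        congr 2
        refine integral_congr_ae (.of_forall fun k => ?_)
        simp only [← integral_mul_const, mul_assoc]

/-- The put replication formula, integrated against the weights. -/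
theorem integral_pos_part_mul_netIntegrate {ρ : Measure ℝ} (h : IsReturnLaw ρ)
    (hg : IntegrableOn W.g (Icc 1 b)) (hb : 1 ≤ b ∨ c = 0) {a x : ℝ} (ha : 0 < a) (hx : x ≤ a) :
    ∫ z in Ioc 0 a, max (z - x) 0 * W.netIntegrate c b (fun k => returnGamma ρ k z) =
      W.netIntegrate c b (fun k => returnPut ρ k x) - W.netIntegrate c b (fun k => returnPut ρ k a)
        - (a - x) * W.netIntegrate c b (fun k => partialMean ρ (k / a)) := by
  have hP : ∀ x, IntegrableOn (fun k => returnPut ρ k x * W.g k) (Icc 1 b) := fun x =>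
    integrableOn_continuous_mul hg (h.lipschitz_returnPut x).continuous
  have hM : IntegrableOn (fun k => ((a - x) * partialMean ρ (k / a)) * W.g k) (Icc 1 b) := by
    have := (integrableOn_partialMean_mul h hg (w := 1) (x := a)).const_mul (a - x)
    simpa [IntegrableOn, mul_assoc] using this
  have hψ : Measurable ((Iio a).indicator fun z => max (z - x) 0) :=
    Measurable.indicator (by fun_prop) measurableSet_Iio
  rw [← netIntegrate_const_mul, ← netIntegrate_sub (hP x) (hP a), ← netIntegrate_sub ?_ hM,
    netIntegrate_congr hb (fun k hk => (h.integral_pos_part_mul_returnGamma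
      (one_pos.trans_le hk) ha hx).symm),
    ← integral_mul_netIntegrate_returnGamma h hg hb hψ (C := a - x)]
  · rw [integral_Ioc_eq_integral_Ioo, ← Ioi_inter_Iio, ← setIntegral_indicator measurableSet_Iio]
    refine integral_congr_ae (.of_forall fun z => ?_)
    simp only [indicator_mul_left]
  · intro z hz
    by_cases hza : z ∈ Iio a
    · rw [indicator_of_mem hza, abs_of_nonneg (le_max_right _ _)]
      have : z < a := hza
      exact max_le (by linarith) (by linarith)
    · rw [indicator_of_notMem hza, abs_zero]
      linarith
  · have := (hP x).sub (hP a)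
    refine this.congr (.of_forall fun k => ?_)
    simp only [Pi.sub_apply, sub_mul]

theorem integrable_put_payoff_mul {ρ : Measure ℝ} (h : IsReturnLaw ρ)
    (hg : IntegrableOn W.g (Icc 1 b)) {w x : ℝ} (hw : 0 ≤ w) (hx : 0 ≤ x) :
    Integrable (fun p : ℝ × ℝ => max (w * p.1 - x * p.2) 0 * W.g p.1)
      ((volume.restrict (Icc 1 b)).prod ρ) := by
  have := h.prob
  have h1 : Integrable (fun p : ℝ × ℝ => W.g p.1) ((volume.restrict (Icc 1 b)).prod ρ) :=
    hg.comp_fst ρ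
  refine h1.bdd_mul (c := w * b) (Measurable.aestronglyMeasurable (by fun_prop)) ?_
  filter_upwards [Measure.quasiMeasurePreserving_fst.ae
      (ae_restrict_mem (μ := volume) (measurableSet_Icc (a := 1) (b := b))),
    Measure.quasiMeasurePreserving_snd.ae h.nonneg] with p hp hp'
  rw [Real.norm_of_nonneg (le_max_right _ _)]
  refine max_le ?_ (mul_nonneg hw (by linarith [hp.1, hp.2]))
  nlinarith [mul_nonneg hx hp', mul_le_mul_of_nonneg_left hp.2 hw]

theorem integrable_integrate_put_payoff {ρ : Measure ℝ} (h : IsReturnLaw ρ)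
    (hg : IntegrableOn W.g (Icc 1 b)) {w x : ℝ} (hw : 0 ≤ w) (hx : 0 ≤ x) :
    Integrable (fun r => W.integrate b (fun k => max (w * k - x * r) 0)) ρ := by
  have := h.prob
  exact ((h.integrable_put_payoff _ _).const_mul _).add
    (integrable_put_payoff_mul h hg hw hx).integral_prod_right

theorem integral_integrate_put_payoff {ρ : Measure ℝ} (h : IsReturnLaw ρ)
    (hg : IntegrableOn W.g (Icc 1 b)) {w x : ℝ} (hw : 0 ≤ w) (hx : 0 ≤ x) :
    ∫ r, W.integrate b (fun k => max (w * k - x * r) 0) ∂ρ =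
      W.integrate b (fun k => returnPut ρ (w * k) x) := by
  have := h.prob
  have h1 := integrable_put_payoff_mul h hg hw hx
  have h2 := integral_integral_swap (f := fun k r => max (w * k - x * r) 0 * W.g k) h1
  simp only [integrate]
  rw [integral_add ((h.integrable_put_payoff _ _).const_mul _) h1.integral_prod_right,
    integral_const_mul, ← h2]
  simp only [integral_mul_const, returnPut]

/-- Joint continuity serves to make the hedge payoff measurable when random level and fund value are
inserted. -/
theorem continuous_integrate_put_payoff (hg : IntegrableOn W.g (Icc 1 b)) :
    Continuous (fun p : ℝ × ℝ => W.integrate b (fun k => max (p.1 * k - p.2) 0)) := by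
  refine Continuous.add (by fun_prop) ?_
  refine continuous_iff_continuousAt.2 fun p => ?_
  refine continuousAt_of_dominated (bound := fun k => (|p.1| + 1) * |b| * ‖W.g k‖
    + (|p.2| + 1) * ‖W.g k‖) ?_ ?_ ?_ ?_
  · exact .of_forall fun q => (integrableOn_continuous_mul hg (by fun_prop)).aestronglyMeasurable
  · filter_upwards [continuous_fst.abs.continuousAt.eventually
      (gt_mem_nhds (show |p.1| < |p.1| + 1 by linarith)),
      continuous_snd.abs.continuousAt.eventually
      (gt_mem_nhds (show |p.2| < |p.2| + 1 by linarith))] with q hq1 hq2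
    filter_upwards [ae_restrict_mem measurableSet_Icc] with k hk
    rw [norm_mul, ← add_mul]
    refine mul_le_mul_of_nonneg_right ?_ (norm_nonneg _)
    rw [Real.norm_of_nonneg (le_max_right _ _)]
    have hkb : |k| ≤ |b| := by
      rw [abs_of_nonneg (by linarith [hk.1]), abs_of_nonneg (by linarith [hk.1, hk.2])]
      exact hk.2
    refine max_le ?_ (by positivity)
    have h1 : q.1 * k ≤ |q.1| * |k| := (le_abs_self _).trans (abs_mul _ _).le
    have h2 : |q.1| * |k| ≤ (|p.1| + 1) * |b| :=
      mul_le_mul hq1.le hkb (abs_nonneg _) (by positivity)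
    linarith [neg_abs_le q.2]
  · exact (hg.norm.const_mul _).add (hg.norm.const_mul _)
  · exact .of_forall fun k => by fun_prop

end Weights

/-! ### Option values and sensitivities in a scaling model -/

/-- The transition law at spot `s > 0` is the law of `s` times a return whose law does not depend
on `s`. -/
structure IsScaling (κ : ℕ → Kernel ℝ ℝ) (N : ℕ) : Prop where
  law : ∀ t < N, IsReturnLaw (κ t 1)
  scale : ∀ t < N, ∀ s, 0 < s → κ t s = (κ t 1).map (fun r => s * r)

variable {κ : ℕ → Kernel ℝ ℝ} {A : ℕ → ℝ} {N t : ℕ}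

theorem IsScaling.integral_eq (h : IsScaling κ N) (ht : t < N) {s : ℝ} (hs : 0 < s) (f : ℝ → ℝ) :
    ∫ y, f y ∂(κ t s) = ∫ r, f (s * r) ∂(κ t 1) := by
  rw [h.scale t ht s hs, (measurableEmbedding_mulLeft₀ hs.ne').integral_map]

theorem IsScaling.integrable_iff (h : IsScaling κ N) (ht : t < N) {s : ℝ} (hs : 0 < s)
    (f : ℝ → ℝ) : Integrable f (κ t s) ↔ Integrable (fun r => f (s * r)) (κ t 1) := by
  rw [h.scale t ht s hs, (measurableEmbedding_mulLeft₀ hs.ne').integrable_map_iff]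
  rfl

theorem IsReturnLaw.integrable_call_payoff {ρ : Measure ℝ} (h : IsReturnLaw ρ) (K x : ℝ) :
    Integrable (fun r => max (x * r - K) 0) ρ := by
  have := h.prob
  exact ((h.integrable.const_mul x).sub (integrable_const K)).pos_part

theorem IsReturnLaw.integral_call_payoff {ρ : Measure ℝ} (h : IsReturnLaw ρ) (K x : ℝ) :
    ∫ r, max (x * r - K) 0 ∂ρ = x - K + returnPut ρ K x := by
  have := h.prob
  have h1 : ∀ r : ℝ, max (x * r - K) 0 = x * r - K + max (K - x * r) 0 := fun r => by
    rcases le_total K (x * r) with hr | hr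
    · rw [max_eq_left (by linarith), max_eq_right (by linarith), add_zero]
    · rw [max_eq_right (by linarith), max_eq_left (by linarith)]
      ring
  have h2 : Integrable (fun r => x * r - K) ρ :=
    (h.integrable.const_mul x).sub (integrable_const K)
  simp_rw [h1]
  rw [integral_add h2 (h.integrable_put_payoff K x),
    integral_sub (h.integrable.const_mul x) (integrable_const K), integral_const_mul, h.mean,
    returnPut]
  simp

theorem returnPut_mul (ρ : Measure ℝ) {c : ℝ} (hc : 0 ≤ c) (K x : ℝ) :
    returnPut ρ (c * K) (c * x) = c * returnPut ρ K x := by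
  rw [returnPut, returnPut, ← integral_const_mul]
  refine integral_congr_ae (.of_forall fun r => ?_)
  simp only [mul_max_of_nonneg _ _ hc, mul_zero, mul_sub, mul_assoc]

theorem IsScaling.put_eq (h : IsScaling κ N) (ht : t < N) {x : ℝ} (hx : 0 < x) (K : ℝ) :
    put κ t K x = returnPut (κ t 1) K x := h.integral_eq ht hx _

theorem IsScaling.call_eq (h : IsScaling κ N) (ht : t < N) {x : ℝ} (hx : 0 < x) (K : ℝ) :
    call κ t K x = x - K + returnPut (κ t 1) K x := by
  rw [call, h.integral_eq ht hx, (h.law t ht).integral_call_payoff]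

theorem IsScaling.hasDerivAt_put (h : IsScaling κ N) (ht : t < N) {K x : ℝ} (hK : 0 < K)
    (hx : 0 < x) : HasDerivAt (put κ t K) (-partialMean (κ t 1) (K / x)) x := by
  refine ((h.law t ht).hasDerivAt_returnPut hK hx).congr_of_eventuallyEq ?_
  filter_upwards [Ioi_mem_nhds hx] with z hz using h.put_eq ht hz K

theorem IsScaling.hasDerivAt_call (h : IsScaling κ N) (ht : t < N) {K x : ℝ} (hK : 0 < K)
    (hx : 0 < x) : HasDerivAt (call κ t K) (1 + -partialMean (κ t 1) (K / x)) x := by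
  refine (((hasDerivAt_id x).sub_const K).add
    ((h.law t ht).hasDerivAt_returnPut hK hx)).congr_of_eventuallyEq ?_
  filter_upwards [Ioi_mem_nhds hx] with z hz using h.call_eq ht hz K

theorem IsScaling.putDelta_eq (h : IsScaling κ N) (ht : t < N) {K x : ℝ} (hK : 0 < K)
    (hx : 0 < x) : putDelta κ t K x = -partialMean (κ t 1) (K / x) :=
  (h.hasDerivAt_put ht hK hx).deriv

theorem IsScaling.callDelta_eq (h : IsScaling κ N) (ht : t < N) {K x : ℝ} (hK : 0 < K)
    (hx : 0 < x) : callDelta κ t K x = 1 + -partialMean (κ t 1) (K / x) :=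
  (h.hasDerivAt_call ht hK hx).deriv

theorem IsScaling.putDelta_eventuallyEq (h : IsScaling κ N) (ht : t < N) {K x : ℝ} (hK : 0 < K)
    (hx : 0 < x) :
    putDelta κ t K =ᶠ[nhds x] fun z => -partialMean (κ t 1) (K / z) := by
  filter_upwards [Ioi_mem_nhds hx] with z hz using h.putDelta_eq ht hK hz

theorem IsScaling.gamma_eq (h : IsScaling κ N) (ht : t < N) {K x : ℝ} (hK : 0 < K)
    (hx : 0 < x) : gamma κ t K x = returnGamma (κ t 1) K x := by
  rw [← deriv_neg_partialMean_const_div _ hK hx]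
  exact (h.putDelta_eventuallyEq ht hK hx).deriv_eq

theorem IsScaling.ae_differentiableAt_putDelta (h : IsScaling κ N) (ht : t < N) {K : ℝ}
    (hK : 0 < K) :
    ∀ᵐ x ∂(volume.restrict (Ioi (0 : ℝ))), DifferentiableAt ℝ (putDelta κ t K) x := by
  filter_upwards [(h.law t ht).ae_differentiableAt hK, ae_restrict_mem measurableSet_Ioi]
    with x hx hx0
  exact hx.congr_of_eventuallyEq (h.putDelta_eventuallyEq ht hK hx0)

/-! ### The recursion for the weights -/

theorem weights_last (ht : ¬ t + 1 < N) :
    weights κ A N t = { α := 0, β := 0, dirac := 1, g := fun _ => 0 } := by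
  rw [weights, dif_neg ht]

/-- The coefficient of the put with strike `b = 1 + A_{t+1}` after put-call parity. -/
noncomputable def kinkWeight (κ : ℕ → Kernel ℝ ℝ) (A : ℕ → ℝ) (N t : ℕ) : ℝ :=
  (weights κ A N t).α / A (t + 1) + (weights κ A N t).β

theorem weights_succ_α (ht : t + 1 < N) : (weights κ A N t).α =
    (weights κ A N (t + 1)).α
        * (1 + 1 / A (t + 2) * call κ (t + 1) (1 + A (t + 2)) (A (t + 1)))
      + (weights κ A N (t + 1)).β * put κ (t + 1) (1 + A (t + 2)) (A (t + 1))
      + (weights κ A N (t + 1)).integrate (1 + A (t + 2))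
          (fun k => put κ (t + 1) k (A (t + 1))) := by
  rw [weights, dif_pos ht]

theorem weights_succ_β (ht : t + 1 < N) : (weights κ A N t).β =
    -((weights κ A N (t + 1)).α / A (t + 2)
        * callDelta κ (t + 1) (1 + A (t + 2)) (A (t + 1))
      + (weights κ A N (t + 1)).β * putDelta κ (t + 1) (1 + A (t + 2)) (A (t + 1))
      + (weights κ A N (t + 1)).integrate (1 + A (t + 2))
          (fun k => putDelta κ (t + 1) k (A (t + 1)))) := by
  rw [weights, dif_pos ht]

theorem weights_succ_dirac (ht : t + 1 < N) : (weights κ A N t).dirac = 0 := by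
  rw [weights, dif_pos ht]

theorem weights_succ_g (ht : t + 1 < N) (k : ℝ) : (weights κ A N t).g k =
    (weights κ A N (t + 1)).netIntegrate (kinkWeight κ A N (t + 1)) (1 + A (t + 2))
      (fun k' => gamma κ (t + 1) k' (k - 1)) := by
  rw [weights, dif_pos ht]
  rfl

/-- At `t = N - 1` the sign of `A N` is unknown, but the mass at that strike vanishes. -/
theorem one_le_or_kinkWeight_eq_zero (hA : ∀ t, 1 ≤ t → t < N → 0 < A t) (t : ℕ) :
    1 ≤ 1 + A (t + 1) ∨ kinkWeight κ A N t = 0 := by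
  by_cases ht : t + 1 < N
  · exact .inl (by linarith [hA (t + 1) (by omega) ht])
  · right
    simp [kinkWeight, weights_last ht]

theorem backward_induction {P : ℕ → Prop} (N : ℕ)
    (step : ∀ t < N, (t + 1 < N → P (t + 1)) → P t) : ∀ t < N, P t := by
  intro t
  induction hn : N - t generalizing t with
  | zero => omega
  | succ n ih => exact fun ht => step t ht fun ht' => ih (t + 1) (by omega) ht'

section Model

variable (h : IsScaling κ N) (hA : ∀ t, 1 ≤ t → t < N → 0 < A t)
include h hA

theorem weights_succ_g_add_one (ht : t + 1 < N) {z : ℝ} (hz : 0 < z) :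
    (weights κ A N t).g (z + 1) =
      (weights κ A N (t + 1)).netIntegrate (kinkWeight κ A N (t + 1)) (1 + A (t + 2))
        (fun k => returnGamma (κ (t + 1) 1) k z) := by
  rw [weights_succ_g ht, add_sub_cancel_right]
  exact Weights.netIntegrate_congr (one_le_or_kinkWeight_eq_zero hA (t + 1))
    fun k hk => h.gamma_eq ht (one_pos.trans_le hk) hz

/-- Integrability passes backwards because a mixture of Gammas with integrable weights is integrable
in the spot; the spot `z` becomes the strike `z + 1`. -/
theorem integrableOn_weights_g : ∀ t < N,
    IntegrableOn (weights κ A N t).g (Icc 1 (1 + A (t + 1))) := by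
  refine backward_induction N fun t ht ih => ?_
  by_cases ht' : t + 1 < N
  · have ha := hA (t + 1) (by omega) ht'
    have h1 := (Weights.integrableOn_netIntegrate_returnGamma (h.law (t + 1) ht') (ih ht')
      (one_le_or_kinkWeight_eq_zero (κ := κ) hA (t + 1))).mono_set
      (Ioc_subset_Ioi_self (a := A (t + 1)) (b := 0))
    have h2 : IntervalIntegrable (fun z => (weights κ A N t).g (z + 1)) volume 0 (A (t + 1)) := by
      rw [intervalIntegrable_iff_integrableOn_Ioc_of_le ha.le]
      exact h1.congr_fun (fun z hz => (weights_succ_g_add_one h hA ht' hz.1).symm)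
        measurableSet_Ioc
    have h3 := h2.comp_sub_right 1
    simp only [sub_add_cancel, zero_add] at h3
    rw [integrableOn_Icc_iff_integrableOn_Ioc,
      ← intervalIntegrable_iff_integrableOn_Ioc_of_le (by linarith), add_comm (1 : ℝ)]
    exact h3
  · rw [weights_last ht']
    exact integrableOn_zero

/-- The Taylor remainder of the next portfolio's value. The shift by one is the unit withdrawal: `k
= z + 1` turns `(k - (x + 1))^+` into `(z - x)^+`. -/
theorem integral_pos_part_mul_weights_g (ht : t + 1 < N) {x : ℝ} (hx : x ≤ A (t + 1)) :
    ∫ k in Icc 1 (1 + A (t + 1)), max (k - (x + 1)) 0 * (weights κ A N t).g k =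
      (weights κ A N (t + 1)).netIntegrate (kinkWeight κ A N (t + 1)) (1 + A (t + 2))
          (fun k => returnPut (κ (t + 1) 1) k x)
        - (weights κ A N (t + 1)).netIntegrate (kinkWeight κ A N (t + 1)) (1 + A (t + 2))
          (fun k => returnPut (κ (t + 1) 1) k (A (t + 1)))
        - (A (t + 1) - x) *
          (weights κ A N (t + 1)).netIntegrate (kinkWeight κ A N (t + 1)) (1 + A (t + 2))
            (fun k => partialMean (κ (t + 1) 1) (k / A (t + 1))) := by
  have ha := hA (t + 1) (by omega) ht
  rw [← Weights.integral_pos_part_mul_netIntegrate (h.law (t + 1) ht)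
    (integrableOn_weights_g h hA (t + 1) ht)
    (one_le_or_kinkWeight_eq_zero (κ := κ) hA (t + 1)) ha hx, integral_Icc_eq_integral_Ioc,
    ← intervalIntegral.integral_of_le (by linarith), ← intervalIntegral.integral_of_le ha.le]
  have h1 := intervalIntegral.integral_comp_add_right (a := 0) (b := A (t + 1))
    (fun k => max (k - (x + 1)) 0 * (weights κ A N t).g k) 1
  rw [zero_add, add_comm (A (t + 1))] at h1
  rw [← h1, intervalIntegral.integral_of_le ha.le, intervalIntegral.integral_of_le ha.le]
  refine setIntegral_congr_fun measurableSet_Ioc fun z hz => ?_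
  simp only [weights_succ_g_add_one h hA ht hz.1]
  ring_nf

-- Put-call parity trades the call for a put and a forward, leaving an affine function plus a
-- mixture of puts; only the puts carry Gamma.
omit hA in
theorem hedgeValue_one_eq (ht : t < N) {x : ℝ} (hx : 0 < x) :
    hedgeValue κ A N t 1 x =
      (weights κ A N t).α * (1 + 1 / A (t + 1) * (x - (1 + A (t + 1))))
        + (weights κ A N t).netIntegrate (kinkWeight κ A N t) (1 + A (t + 1))
          (fun k => returnPut (κ t 1) k x) := by
  simp only [hedgeValue, Weights.netIntegrate, kinkWeight, h.put_eq ht hx, h.call_eq ht hx, one_mul]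
  ring

omit h hA in
theorem hedgePayoff_one_eq (κ : ℕ → Kernel ℝ ℝ) (A : ℕ → ℝ) (N t : ℕ) (y : ℝ) :
    hedgePayoff κ A N t 1 y =
      (weights κ A N t).α * (1 + 1 / A (t + 1) * (y - (1 + A (t + 1))))
        + (weights κ A N t).netIntegrate (kinkWeight κ A N t) (1 + A (t + 1))
          (fun k => max (k - y) 0) := by
  have h1 : max (y - (1 + A (t + 1))) 0 = y - (1 + A (t + 1)) + max (1 + A (t + 1) - y) 0 := by
    rcases le_total (1 + A (t + 1)) y with hy | hy
    · rw [max_eq_left (by linarith), max_eq_right (by linarith), add_zero]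
    · rw [max_eq_right (by linarith), max_eq_left (by linarith)]
      ring
  simp only [hedgePayoff, Weights.netIntegrate, kinkWeight, one_mul, h1]
  ring

omit h hA in
theorem weights_α_eq (ht : t + 1 < N) :
    (weights κ A N t).α = hedgeValue κ A N (t + 1) 1 (A (t + 1)) := by
  rw [weights_succ_α ht]
  simp only [hedgeValue, one_mul]

theorem weights_β_eq (ht : t + 1 < N) : (weights κ A N t).β =
    -((weights κ A N (t + 1)).α / A (t + 2)) +
      (weights κ A N (t + 1)).netIntegrate (kinkWeight κ A N (t + 1)) (1 + A (t + 2))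
          (fun k => partialMean (κ (t + 1) 1) (k / A (t + 1))) := by
  have ha := hA (t + 1) (by omega) ht
  have h1 : (weights κ A N (t + 1)).integrate (1 + A (t + 2))
      (fun k => putDelta κ (t + 1) k (A (t + 1))) =
      -(weights κ A N (t + 1)).integrate (1 + A (t + 2))
          (fun k => partialMean (κ (t + 1) 1) (k / A (t + 1))) := by
    rw [← neg_one_mul, ← Weights.integrate_const_mul]
    refine Weights.integrate_congr fun k hk => ?_
    rw [h.putDelta_eq ht (one_pos.trans_le hk) ha, neg_one_mul]
  have h2 : (weights κ A N (t + 1)).α / A (t + 2)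
        * callDelta κ (t + 1) (1 + A (t + 2)) (A (t + 1))
      + (weights κ A N (t + 1)).β * putDelta κ (t + 1) (1 + A (t + 2)) (A (t + 1)) =
      (weights κ A N (t + 1)).α / A (t + 2) - kinkWeight κ A N (t + 1)
        * partialMean (κ (t + 1) 1) ((1 + A (t + 2)) / A (t + 1)) := by
    -- At the last date the strike `1 + A N` need not be positive, but both coefficients are zero.
    by_cases ht' : t + 1 + 1 < N
    · have hb : 0 < 1 + A (t + 2) := by linarith [hA (t + 2) (by omega) ht']
      rw [h.putDelta_eq ht hb ha, h.callDelta_eq ht hb ha, kinkWeight]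
      ring
    · simp [kinkWeight, weights_last ht']
  rw [weights_succ_β ht, h1, h2, Weights.netIntegrate]
  ring

/-- Taylor's formula at `A (t + 1)`: `α` is the value there, `-β` the slope, and the puts supply the
remainder. Nonpositive `x` is allowed on purpose, to cover depletion. -/
theorem hedgePayoff_one_add_one (ht : t + 1 < N) {x : ℝ} (hx : x ≤ A (t + 1)) :
    hedgePayoff κ A N t 1 (x + 1) =
      (weights κ A N (t + 1)).α * (1 + 1 / A (t + 2) * (x - (1 + A (t + 2))))
        + (weights κ A N (t + 1)).netIntegrate (kinkWeight κ A N (t + 1)) (1 + A (t + 2))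
          (fun k => returnPut (κ (t + 1) 1) k x) := by
  have ha := hA (t + 1) (by omega) ht
  simp only [hedgePayoff, Weights.integrate, weights_succ_dirac ht, one_mul, zero_mul, zero_add]
  rw [integral_pos_part_mul_weights_g h hA ht hx, weights_α_eq ht, weights_β_eq h hA ht,
    hedgeValue_one_eq h ht ha, max_eq_right (by linarith), max_eq_left (by linarith)]
  ring

theorem hedgePayoff_one_of_le_one : ∀ t < N, ∀ y ≤ 1,
    hedgePayoff κ A N t 1 y = (N : ℝ) - t - y := by
  refine backward_induction N fun t ht ih => ?_
  intro y hy
  by_cases ht' : t + 1 < N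
  · have ha := hA (t + 1) (by omega) ht'
    obtain ⟨x, rfl⟩ : ∃ x, y = x + 1 := ⟨y - 1, by ring⟩
    have hx : x ≤ 0 := by linarith
    have h1 := ih ht' x (by linarith)
    rw [hedgePayoff_one_eq] at h1
    rw [hedgePayoff_one_add_one h hA ht' (by linarith)]
    -- For `x ≤ 0` put price and put payoff coincide, so the right-hand side is the payoff one date
    -- later at `x`.
    have h2 := Weights.netIntegrate_congr (W := weights κ A N (t + 1))
      (b := 1 + A (t + 1 + 1)) (one_le_or_kinkWeight_eq_zero (κ := κ) hA (t + 1))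
      (f := fun k => returnPut (κ (t + 1) 1) k x) (f' := fun k => max (k - x) 0) fun k hk => by
        rw [(h.law _ ht').returnPut_of_nonpos (by linarith) hx, max_eq_left (by linarith)]
    rw [h2, h1]
    push_cast
    ring
  · have hN : (N : ℝ) = t + 1 := by exact_mod_cast (by omega : N = t + 1)
    simp [hedgePayoff, weights_last ht', Weights.integrate, hN, hy]

omit h hA in
theorem hedgePayoff_mul (κ : ℕ → Kernel ℝ ℝ) (A : ℕ → ℝ) (N t : ℕ) {c : ℝ} (hc : 0 ≤ c) (w y : ℝ) :
    hedgePayoff κ A N t (c * w) (c * y) = c * hedgePayoff κ A N t w y := by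
  have h1 : ∀ u v : ℝ, max (c * u - c * v) 0 = c * max (u - v) 0 := fun u v => by
    rw [mul_max_of_nonneg _ _ hc, mul_sub, mul_zero]
  simp only [hedgePayoff, mul_assoc, h1, Weights.integrate_const_mul]
  ring

omit hA in
theorem hedgeValue_mul (ht : t < N) {c w x : ℝ} (hc : 0 < c) (hx : 0 < x) :
    hedgeValue κ A N t (c * w) (c * x) = c * hedgeValue κ A N t w x := by
  simp only [hedgeValue, h.put_eq ht hx, h.call_eq ht hx, h.put_eq ht (mul_pos hc hx),
    h.call_eq ht (mul_pos hc hx), mul_assoc, returnPut_mul _ hc.le, Weights.integrate_const_mul]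
  ring

/-- Above the withdrawal the payoff is the value of the next portfolio after the roll-up. -/
theorem hedgePayoff_eq_hedgeValue (ht : t + 1 < N) {w y : ℝ} (hw : 0 < w) (hy : w < y) :
    hedgePayoff κ A N t w y =
      hedgeValue κ A N (t + 1) (max w ((y - w) / A (t + 1))) (y - w) := by
  have ha := hA (t + 1) (by omega) ht
  obtain ⟨x, hx, rfl⟩ : ∃ x, 0 < x ∧ y = w * (x + 1) :=
    ⟨(y - w) / w, div_pos (by linarith) hw, by field_simp; ring⟩
  have h1 : w * (x + 1) - w = w * x := by ring
  have h2 := hedgePayoff_mul κ A N t hw.le 1 (x + 1)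
  rw [mul_one] at h2
  rw [h1, h2]
  rcases le_total x (A (t + 1)) with hxa | hxa
  · have h3 : w * x / A (t + 1) ≤ w := by
      rw [div_le_iff₀ ha]
      exact mul_le_mul_of_nonneg_left hxa hw.le
    have h4 := hedgeValue_mul (A := A) (w := 1) h ht hw hx
    rw [mul_one] at h4
    rw [max_eq_left h3, h4, hedgePayoff_one_add_one h hA ht hxa, hedgeValue_one_eq h ht hx]
  -- Roll-up region: homogeneity moves the new level to `1` and the fund to `A (t + 1)`, where the
  -- portfolio is worth `α`; no put pays.
  · have h3 : w ≤ w * x / A (t + 1) := by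
      rw [le_div_iff₀ ha]
      exact mul_le_mul_of_nonneg_left hxa hw.le
    have h4 := hedgeValue_mul (A := A) (w := 1) h ht
      (show 0 < w * x / A (t + 1) by positivity) ha
    rw [mul_one, div_mul_cancel₀ _ ha.ne'] at h4
    rw [max_eq_right h3, h4, ← weights_α_eq ht]
    have h5 : ∫ k in Icc 1 (1 + A (t + 1)), max (k - (x + 1)) 0 * (weights κ A N t).g k = 0 := by
      refine setIntegral_eq_zero_of_forall_eq_zero fun k hk => ?_
      rw [max_eq_right (by linarith [hk.2]), zero_mul]
    simp only [hedgePayoff, Weights.integrate, weights_succ_dirac ht, one_mul, zero_mul, h5]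
    rw [max_eq_left (by linarith), max_eq_right (by linarith)]
    field_simp
    ring

theorem hedgePayoff_of_le (ht : t < N) {w y : ℝ} (hw : 0 < w) (hy : y ≤ w) :
    hedgePayoff κ A N t w y = ((N : ℝ) - t) * w - y := by
  have h1 := hedgePayoff_mul κ A N t hw.le 1 (y / w)
  rw [mul_one, mul_div_cancel₀ _ hw.ne',
    hedgePayoff_one_of_le_one h hA t ht (y / w) ((div_le_one hw).2 hy)] at h1
  rw [h1]
  field_simp

theorem integrable_hedgePayoff (ht : t < N) {w x : ℝ} (hw : 0 ≤ w) (hx : 0 ≤ x) :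
    Integrable (fun r => hedgePayoff κ A N t w (x * r)) (κ t 1) := by
  have hl := h.law t ht
  have := hl.prob
  exact ((((integrable_const w).add ((hl.integrable_call_payoff _ x).const_mul _)).const_mul _).add
    ((hl.integrable_put_payoff _ x).const_mul _)).add
    (Weights.integrable_integrate_put_payoff hl (integrableOn_weights_g h hA t ht) hw hx)

theorem integral_hedgePayoff (ht : t < N) {w x : ℝ} (hw : 0 ≤ w) (hx : 0 < x) :
    ∫ r, hedgePayoff κ A N t w (x * r) ∂(κ t 1) = hedgeValue κ A N t w x := by
  have hl := h.law t ht
  have := hl.prob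
  have hc : Integrable (fun r => w + 1 / A (t + 1) * max (x * r - w * (1 + A (t + 1))) 0)
      (κ t 1) := (integrable_const w).add ((hl.integrable_call_payoff _ x).const_mul _)
  have hp := (hl.integrable_put_payoff (w * (1 + A (t + 1))) x).const_mul (weights κ A N t).β
  have hi := Weights.integrable_integrate_put_payoff hl (integrableOn_weights_g h hA t ht) hw hx.le
  have hcp : Integrable (fun r => (weights κ A N t).α
        * (w + 1 / A (t + 1) * max (x * r - w * (1 + A (t + 1))) 0)
      + (weights κ A N t).β * max (w * (1 + A (t + 1)) - x * r) 0) (κ t 1) :=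
    (hc.const_mul _).add hp
  simp only [hedgePayoff, hedgeValue, h.put_eq ht hx, h.call_eq ht hx]
  rw [integral_add hcp hi, integral_add (hc.const_mul _) hp,
    integral_const_mul, integral_const_mul, Weights.integral_integrate_put_payoff hl
      (integrableOn_weights_g h hA t ht) hw hx.le,
    integral_add (integrable_const w) ((hl.integrable_call_payoff _ x).const_mul _),
    integral_const_mul, hl.integral_call_payoff]
  simp [returnPut]

/-! ### The value function -/

omit hA in
theorem valueFun_integrand_ae_eq (ht : t < N)
    (hR : ∀ w, 0 < w → ∀ y, 0 ≤ y → ∀ s, 0 < s ∨ y ≤ w →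
      hedgePayoff κ A N t w y = valueFun κ A N (t + 1) w (y - w) s)
    {w x s : ℝ} (hw : 0 < w) (hx : 0 < x) (hs : 0 < s) :
    (fun r => hedgePayoff κ A N t w (x * r)) =ᵐ[κ t 1]
      fun r => valueFun κ A N (t + 1) w (x * (s * r / s) - w) (s * r) := by
  filter_upwards [(h.law t ht).nonneg] with r hr
  rw [mul_div_cancel_left₀ _ hs.ne']
  refine hR w hw (x * r) (mul_nonneg hx.le hr) (s * r) ?_
  rcases hr.eq_or_lt with rfl | hr
  · exact .inr (by simpa using hw.le)
  · exact .inl (mul_pos hs hr)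

theorem valueBar_eq_of_replication (ht : t < N)
    (hR : ∀ w, 0 < w → ∀ y, 0 ≤ y → ∀ s, 0 < s ∨ y ≤ w →
      hedgePayoff κ A N t w y = valueFun κ A N (t + 1) w (y - w) s)
    {w x s : ℝ} (hw : 0 < w) (hx : 0 < x) (hs : 0 < s) :
    Integrable (fun y => valueFun κ A N (t + 1) w (x * (y / s) - w) y) (κ t s) ∧
      valueBar κ A N t w x s = hedgeValue κ A N t w x := by
  have h1 := valueFun_integrand_ae_eq h ht hR hw hx hs
  refine ⟨(h.integrable_iff ht hs _).2 ((integrable_hedgePayoff h hA ht hw.le hx.le).congr h1), ?_⟩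
  rw [valueBar, h.integral_eq ht hs, ← integral_congr_ae h1, integral_hedgePayoff h hA ht hw.le hx]

/-- The alternative `0 < s ∨ y ≤ w` closes the induction. The price may hit `0`, where scaling says
nothing, but then the fund before the withdrawal is `0`, and the depleted branch of `valueFun` does
not see `s`. -/
theorem replication : ∀ t < N, ∀ w, 0 < w → ∀ y, 0 ≤ y → ∀ s, 0 < s ∨ y ≤ w →
    hedgePayoff κ A N t w y = valueFun κ A N (t + 1) w (y - w) s := by
  refine backward_induction N fun t ht ih => ?_
  intro w hw y hy s hs
  by_cases hyw : y ≤ w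
  · rw [hedgePayoff_of_le h hA ht hw hyw, valueFun, if_pos (by linarith)]
    push_cast
    ring
  · have hs : 0 < s := hs.resolve_right hyw
    rw [not_le] at hyw
    rw [valueFun, if_neg (by linarith)]
    by_cases ht' : t + 1 < N
    · rw [dif_pos ht', hedgePayoff_eq_hedgeValue h hA ht' hw hyw]
      exact (valueBar_eq_of_replication h hA ht' (ih ht') (lt_max_of_lt_left hw)
        (by linarith) hs).2.symm
    · rw [dif_neg ht']
      simp [hedgePayoff, weights_last ht', Weights.integrate, hyw.le]

theorem valueBar_eq (ht : t < N) {w x s : ℝ} (hw : 0 < w) (hx : 0 < x) (hs : 0 < s) :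
    Integrable (fun y => valueFun κ A N (t + 1) w (x * (y / s) - w) y) (κ t s) ∧
      valueBar κ A N t w x s = hedgeValue κ A N t w x :=
  valueBar_eq_of_replication h hA ht (replication h hA t ht) hw hx hs

end Model

/-! ### Identification of the transition laws -/

theorem integrable_put_payoff_of_nonneg {μ : Measure ℝ} [IsFiniteMeasure μ]
    (hμ : ∀ᵐ y ∂μ, 0 ≤ y) {K : ℝ} (hK : 0 ≤ K) : Integrable (fun y => max (K - y) 0) μ := by
  refine Integrable.of_bound (Measurable.aestronglyMeasurable (by fun_prop)) K ?_
  filter_upwards [hμ] with y hy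
  rw [Real.norm_of_nonneg (le_max_right _ _)]
  exact max_le (by linarith) hK

/-- Normalised put spreads tend boundedly to the indicator of `(-∞, a]`. Moving the upper strike
down to `a` includes a possible atom at `a`. -/
theorem tendsto_put_spread {μ : Measure ℝ} [IsFiniteMeasure μ] (hμ : ∀ᵐ y ∂μ, 0 ≤ y) {a : ℝ}
    (ha : 0 ≤ a) : Filter.Tendsto (fun n : ℕ => ((n : ℝ) + 1) *
      ((∫ y, max (a + 1 / ((n : ℝ) + 1) - y) 0 ∂μ) - ∫ y, max (a - y) 0 ∂μ))
      Filter.atTop (nhds (μ.real (Iic a))) := by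
  have h0 : ∀ n : ℕ, (0 : ℝ) < 1 / ((n : ℝ) + 1) := fun n => by positivity
  have h1 : ∀ n : ℕ, ((n : ℝ) + 1) *
      ((∫ y, max (a + 1 / ((n : ℝ) + 1) - y) 0 ∂μ) - ∫ y, max (a - y) 0 ∂μ) =
      ∫ y, ((n : ℝ) + 1) * (max (a + 1 / ((n : ℝ) + 1) - y) 0 - max (a - y) 0) ∂μ := fun n => by
    rw [integral_const_mul, integral_sub
      (integrable_put_payoff_of_nonneg hμ (by linarith [h0 n]))
      (integrable_put_payoff_of_nonneg hμ ha)]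
  simp_rw [h1]
  rw [← integral_indicator_one measurableSet_Iic]
  refine tendsto_integral_of_dominated_convergence (fun _ => 1)
    (fun n => Measurable.aestronglyMeasurable (by fun_prop)) (integrable_const _)
    (fun n => .of_forall fun y => ?_) (.of_forall fun y => ?_)
  · have hn : (0 : ℝ) < (n : ℝ) + 1 := by positivity
    rw [norm_mul, Real.norm_of_nonneg hn.le, ← le_div_iff₀' hn]
    refine (abs_max_sub_max_le_abs _ _ _).trans_eq ?_
    rw [show a + 1 / ((n : ℝ) + 1) - y - (a - y) = 1 / ((n : ℝ) + 1) by ring, abs_of_pos (h0 n)]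
  · by_cases hy : y ∈ Iic a
    · rw [indicator_of_mem hy]
      have hy : y ≤ a := hy
      refine tendsto_const_nhds.congr fun n => ?_
      rw [max_eq_left (by linarith [h0 n]), max_eq_left (by linarith)]
      have hn : (n : ℝ) + 1 ≠ 0 := by positivity
      rw [Pi.one_apply, show a + 1 / ((n : ℝ) + 1) - y - (a - y) = 1 / ((n : ℝ) + 1) by ring,
        mul_one_div_cancel hn]
    · rw [indicator_of_notMem hy]
      have hy : a < y := not_le.1 hy
      refine (tendsto_const_nhds (x := (0 : ℝ))).congr' ?_
      filter_upwards [tendsto_one_div_add_atTop_nhds_zero_nat.eventually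
        (gt_mem_nhds (show (0 : ℝ) < y - a by linarith))] with n hn
      rw [max_eq_right (by linarith), max_eq_right (by linarith), sub_zero, mul_zero]

/-- A law on `[0, ∞)` is determined by its put values. -/
theorem measure_eq_of_put_eq {μ ν : Measure ℝ} [IsFiniteMeasure μ] [IsFiniteMeasure ν]
    (hμ : ∀ᵐ y ∂μ, 0 ≤ y) (hν : ∀ᵐ y ∂ν, 0 ≤ y)
    (hput : ∀ K, 0 < K → ∫ y, max (K - y) 0 ∂μ = ∫ y, max (K - y) 0 ∂ν) : μ = ν := by
  have h0 : ∀ {μ : Measure ℝ}, (∀ᵐ y ∂μ, 0 ≤ y) → ∫ y, max (0 - y) 0 ∂μ = 0 := fun {μ} hμ => by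
    refine integral_eq_zero_of_ae ?_
    filter_upwards [hμ] with y hy
    exact max_eq_right (by linarith)
  refine Measure.ext_of_Iic μ ν fun a => ?_
  rcases lt_or_ge a 0 with ha | ha
  · have h1 : ∀ {μ : Measure ℝ}, (∀ᵐ y ∂μ, 0 ≤ y) → μ (Iic a) = 0 := fun {μ} hμ => by
      refine measure_mono_null (fun y hy => ?_) (ae_iff.1 hμ)
      have hy : y ≤ a := hy
      simp only [mem_ofPred_eq]
      linarith
    rw [h1 hμ, h1 hν]
  · have h1 := tendsto_put_spread hμ ha
    have h2 := tendsto_put_spread hν ha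
    have h3 : ∫ y, max (a - y) 0 ∂μ = ∫ y, max (a - y) 0 ∂ν := by
      rcases ha.eq_or_lt with rfl | ha
      · rw [h0 hμ, h0 hν]
      · exact hput a ha
    have h4 : ∀ n : ℕ, ∫ y, max (a + 1 / ((n : ℝ) + 1) - y) 0 ∂μ =
        ∫ y, max (a + 1 / ((n : ℝ) + 1) - y) 0 ∂ν := fun n => hput _ (by positivity)
    simp_rw [h3, h4] at h1
    have h5 := tendsto_nhds_unique h1 h2
    exact (measureReal_eq_measureReal_iff (measure_ne_top _ _) (measure_ne_top _ _)).1 h5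

theorem kernel_eq_map_of_put_scaling {κ : ℕ → Kernel ℝ ℝ} [∀ t, IsMarkovKernel (κ t)] {N t : ℕ}
    (hnonneg : ∀ s, 0 ≤ s → κ t s (Iio 0) = 0) (hA2 : AssumptionA2 κ N) (ht : t < N) {s : ℝ}
    (hs : 0 < s) : κ t s = (κ t 1).map (fun r => s * r) := by
  have hn : ∀ s, 0 < s → ∀ᵐ y ∂(κ t s), 0 ≤ y := fun s hs => by
    rw [ae_iff]
    simpa [Iio] using hnonneg s hs.le
  have hm : Measurable fun r : ℝ => s * r := by fun_prop
  have := Measure.isFiniteMeasure_map (κ t 1) (fun r => s * r)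
  refine measure_eq_of_put_eq (hn s hs) ?_ fun K hK => ?_
  · rw [ae_map_iff hm.aemeasurable measurableSet_Ici]
    filter_upwards [hn 1 one_pos] with r hr using mul_nonneg hs.le hr
  · rw [(measurableEmbedding_mulLeft₀ hs.ne').integral_map]
    -- Base spot `1` and base strike `K / s`, scaled up by `s`.
    have h1 := hA2 t ht s hs (K / s) (div_pos hK hs) 1 one_pos
    rw [mul_div_cancel₀ _ hs.ne', mul_one] at h1
    refine h1.trans ?_
    rw [put, ← integral_const_mul]
    refine integral_congr_ae (.of_forall fun r => ?_)
    simp only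
    rw [mul_max_of_nonneg _ _ hs.le, mul_zero, mul_sub, mul_div_cancel₀ _ hs.ne']

/-! ### Conditional expectations under the transition kernel -/

section Markov

variable {Ω β : Type*} {m : MeasurableSpace Ω} {mβ : MeasurableSpace β} {Q : Measure Ω}
  [IsProbabilityMeasure Q] {X : Ω → β} {Y : Ω → ℝ} {η : Kernel β ℝ} [IsMarkovKernel η]

/-- The conditional probabilities in the hypothesis fix the joint law on rectangles, which generate
the product σ-algebra. -/
theorem map_prodMk_eq_compProd (hX : Measurable X) (hY : Measurable Y)
    (hη : ∀ B, MeasurableSet B → Q[(Y ⁻¹' B).indicator (fun _ => (1 : ℝ)) | mβ.comap X] =ᵐ[Q]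
      fun ω => (η (X ω)).real B) :
    Q.map (fun ω => (X ω, Y ω)) = Q.map X ⊗ₘ η := by
  have := Measure.isProbabilityMeasure_map (μ := Q) hX.aemeasurable
  have := Measure.isProbabilityMeasure_map (μ := Q) (hX.prodMk hY).aemeasurable
  refine Measure.ext_prod fun {s B} hs hB => ?_
  rw [Measure.map_apply (hX.prodMk hY) (hs.prod hB), Measure.compProd_apply_prod hs hB,
    setLIntegral_map hs (η.measurable_coe hB) hX]
  have h1 : Integrable ((Y ⁻¹' B).indicator (fun _ => (1 : ℝ))) Q :=
    (integrable_const _).indicator (hY hB)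
  have h2 := setIntegral_condExp hX.comap_le h1 (s := X ⁻¹' s) ⟨s, hs, rfl⟩
  rw [setIntegral_congr_ae (hX hs) ((hη B hB).mono fun ω hω _ => hω),
    setIntegral_indicator (hY hB), setIntegral_const, smul_eq_mul, mul_one] at h2
  have h3 : ∫⁻ ω in X ⁻¹' s, η (X ω) B ∂Q =
      ENNReal.ofReal (∫ ω in X ⁻¹' s, (η (X ω)).real B ∂Q) := by
    rw [ofReal_integral_eq_lintegral_ofReal]
    · simp
    · refine Integrable.of_bound (C := 1) ?_ (.of_forall fun ω => ?_)
      · exact (((η.measurable_coe hB).comp hX).ennreal_toReal).aestronglyMeasurable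
      · rw [Real.norm_of_nonneg measureReal_nonneg]
        exact measureReal_le_one
    · exact .of_forall fun ω => measureReal_nonneg
  rw [h3, h2, ofReal_measureReal]
  rfl

theorem condExp_eq_integral_kernel (hX : Measurable X) (hY : Measurable Y)
    (hη : ∀ B, MeasurableSet B → Q[(Y ⁻¹' B).indicator (fun _ => (1 : ℝ)) | mβ.comap X] =ᵐ[Q]
      fun ω => (η (X ω)).real B) {F : β × ℝ → ℝ} (hF : StronglyMeasurable F)
    (hi : Integrable (fun ω => F (X ω, Y ω)) Q) :
    Q[fun ω => F (X ω, Y ω) | mβ.comap X] =ᵐ[Q] fun ω => ∫ y, F (X ω, y) ∂(η (X ω)) := by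
  have h1 := condDistrib_ae_eq_of_measure_eq_compProd_of_measurable hX hY
    (map_prodMk_eq_compProd hX hY hη)
  filter_upwards [condExp_prod_ae_eq_integral_condDistrib hX hY.aemeasurable hF hi,
    ae_of_ae_map hX.aemeasurable h1] with ω hω hω'
  rw [hω, hω']

theorem integrable_prodMk_iff_kernel (hX : Measurable X) (hY : Measurable Y)
    (hη : ∀ B, MeasurableSet B → Q[(Y ⁻¹' B).indicator (fun _ => (1 : ℝ)) | mβ.comap X] =ᵐ[Q]
      fun ω => (η (X ω)).real B) {F : β × ℝ → ℝ} (hF : StronglyMeasurable F) :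
    Integrable (fun ω => F (X ω, Y ω)) Q ↔
      (∀ᵐ ω ∂Q, Integrable (fun y => F (X ω, y)) (η (X ω))) ∧
      Integrable (fun ω => ∫ y, ‖F (X ω, y)‖ ∂(η (X ω))) Q := by
  have h1 : Integrable (fun ω => F (X ω, Y ω)) Q ↔ Integrable F (Q.map X ⊗ₘ η) := by
    rw [← map_prodMk_eq_compProd hX hY hη,
      integrable_map_measure hF.aestronglyMeasurable (hX.prodMk hY).aemeasurable]
    rfl
  have h2 : StronglyMeasurable fun x => ∫ y, ‖F (x, y)‖ ∂(η x) :=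
    hF.norm.integral_kernel_prod_right'
  rw [h1, Measure.integrable_compProd_iff hF.aestronglyMeasurable,
    integrable_map_measure h2.aestronglyMeasurable hX.aemeasurable,
    ae_map_iff hX.aemeasurable
      (measurableSet_kernel_integrable (f := fun x y => F (x, y)) hF)]
  rfl

end Markov

section Market

variable {Ω : Type*} {m : MeasurableSpace Ω} {Q : Measure Ω} [IsProbabilityMeasure Q]
  {ℱ : Filtration ℕ m} {S : ℕ → Ω → ℝ} {κ : ℕ → Kernel ℝ ℝ} [∀ t, IsMarkovKernel (κ t)] {N t : ℕ}

theorem AssumptionA1.condExp_eq (hA1 : AssumptionA1 Q ℱ S κ N) (hS : Martingale S ℱ Q)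
    (ht : t < N) {F : Ω × ℝ → ℝ} (hF : StronglyMeasurable[(ℱ t).prod inferInstance] F)
    (hi : Integrable (fun ω => F (ω, S (t + 1) ω)) Q) :
    Q[fun ω => F (ω, S (t + 1) ω) | ℱ t] =ᵐ[Q] fun ω => ∫ y, F (ω, y) ∂(κ t (S t ω)) := by
  -- Conditioning is on the identity from `(Ω, m)` to `(Ω, ℱ t)`, so `F` may use the whole past:
  -- level and fund are not functions of `S t`.
  have h1 := @condExp_eq_integral_kernel Ω Ω m (ℱ t) Q _ id (S (t + 1))
    (@Kernel.comap ℝ ℝ _ _ Ω (ℱ t) (κ t) (S t) (hS.1 t).measurable)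
    (@Kernel.IsMarkovKernel.comap ℝ ℝ _ _ Ω (ℱ t) (S t) (κ t) _ (hS.1 t).measurable) (ℱ.le t)
    ((hS.1 (t + 1)).measurable.mono (ℱ.le _) le_rfl)
    (by rw [MeasurableSpace.comap_id]; exact hA1.markov t ht) F hF hi
  rw [MeasurableSpace.comap_id] at h1
  exact h1

theorem AssumptionA1.integrable_iff (hA1 : AssumptionA1 Q ℱ S κ N) (hS : Martingale S ℱ Q)
    (ht : t < N) {F : Ω × ℝ → ℝ} (hF : StronglyMeasurable[(ℱ t).prod inferInstance] F) :
    Integrable (fun ω => F (ω, S (t + 1) ω)) Q ↔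
      (∀ᵐ ω ∂Q, Integrable (fun y => F (ω, y)) (κ t (S t ω))) ∧
      Integrable (fun ω => ∫ y, ‖F (ω, y)‖ ∂(κ t (S t ω))) Q :=
  @integrable_prodMk_iff_kernel Ω Ω m (ℱ t) Q _ id (S (t + 1))
    (@Kernel.comap ℝ ℝ _ _ Ω (ℱ t) (κ t) (S t) (hS.1 t).measurable)
    (@Kernel.IsMarkovKernel.comap ℝ ℝ _ _ Ω (ℱ t) (S t) (κ t) _ (hS.1 t).measurable) (ℱ.le t)
    ((hS.1 (t + 1)).measurable.mono (ℱ.le _) le_rfl)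
    (by rw [MeasurableSpace.comap_id]; exact hA1.markov t ht) F hF

omit [∀ t, IsMarkovKernel (κ t)] in
theorem AssumptionA1.price_nonneg (hA1 : AssumptionA1 Q ℱ S κ N) (hS : Martingale S ℱ Q)
    (hS0 : ∀ᵐ ω ∂Q, S 0 ω = 1) : ∀ t ≤ N, ∀ᵐ ω ∂Q, 0 ≤ S t ω := by
  intro t
  induction t with
  | zero =>
    intro _
    filter_upwards [hS0] with ω hω
    rw [hω]
    exact zero_le_one
  | succ t ih =>
    intro ht
    have hm : MeasurableSet (S (t + 1) ⁻¹' Iio 0) :=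
      (hS.1 (t + 1)).measurable.mono (ℱ.le _) le_rfl measurableSet_Iio
    have h1 := integral_condExp (ℱ.le t) (μ := Q)
      (f := (S (t + 1) ⁻¹' Iio 0).indicator (fun _ => (1 : ℝ)))
    have h2 : ∫ ω, (κ t (S t ω)).real (Iio 0) ∂Q = 0 := by
      refine integral_eq_zero_of_ae ?_
      filter_upwards [ih (by omega)] with ω hω
      simp [Measure.real, hA1.nonneg t (by omega) _ hω]
    rw [integral_congr_ae (hA1.markov t (by omega) _ measurableSet_Iio), h2,
      integral_indicator hm, setIntegral_const, smul_eq_mul, mul_one] at h1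
    rw [ae_iff]
    have h3 := (measureReal_eq_zero_iff (measure_ne_top _ _)).1 h1.symm
    simpa [preimage] using h3

theorem AssumptionA1.isReturnLaw (hA1 : AssumptionA1 Q ℱ S κ N) (hA2 : AssumptionA2 κ N)
    (hS : Martingale S ℱ Q) (hS0 : ∀ᵐ ω ∂Q, S 0 ω = 1) (ht : t < N) : IsReturnLaw (κ t 1) := by
  have hF : StronglyMeasurable[(ℱ t).prod inferInstance] (fun p : Ω × ℝ => p.2) :=
    (@measurable_snd Ω ℝ (ℱ t) _).stronglyMeasurable
  have h1 := ((hA1.integrable_iff hS ht hF).1 (hS.integrable (t + 1))).1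
  have h2 := hA1.condExp_eq hS ht hF (hS.integrable (t + 1))
  have hone : ∫ ω, S t ω ∂Q = 1 := by
    have h3 := hS.setIntegral_eq (Nat.zero_le t) (s := univ) MeasurableSet.univ
    simp only [setIntegral_univ] at h3
    rw [← h3, integral_congr_ae hS0]
    simp
  have hpos : ∃ᵐ ω ∂Q, 0 < S t ω := by
    intro hle
    have h3 : ∫ ω, S t ω ∂Q ≤ 0 :=
      integral_nonpos_of_ae (hle.mono fun ω hω => not_lt.1 hω)
    linarith
  -- Since `E[S t] = 1`, some path with `S t ω > 0` satisfies all the almost sure identities. At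
  -- that single path the martingale identity reads `S t ω * E[R] = S t ω`.
  obtain ⟨ω, hω, hi, hc, hmart⟩ :=
    (hpos.and_eventually (h1.and (h2.and (hS.2 t (t + 1) (Nat.le_succ t))))).exists
  rw [hmart] at hc
  simp only at hi hc
  have hk := kernel_eq_map_of_put_scaling (hA1.nonneg t ht) hA2 ht hω
  have hemb := measurableEmbedding_mulLeft₀ hω.ne'
  rw [hk, hemb.integral_map, integral_const_mul] at hc
  rw [hk, hemb.integrable_map_iff] at hi
  refine ⟨inferInstance, ?_, ?_, ?_, hA1.continuous t ht 1 one_pos⟩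
  · rw [ae_iff]
    simpa [Iio] using hA1.nonneg t ht 1 zero_le_one
  · refine (hi.const_mul (S t ω)⁻¹).congr (.of_forall fun r => ?_)
    simp [inv_mul_cancel_left₀ hω.ne']
  · exact mul_left_cancel₀ hω.ne' (hc.symm.trans (mul_one _).symm)

theorem AssumptionA1.isScaling (hA1 : AssumptionA1 Q ℱ S κ N) (hA2 : AssumptionA2 κ N)
    (hS : Martingale S ℱ Q) (hS0 : ∀ᵐ ω ∂Q, S 0 ω = 1) : IsScaling κ N where
  law _ ht := hA1.isReturnLaw hA2 hS hS0 ht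
  scale t ht _ hs := kernel_eq_map_of_put_scaling (hA1.nonneg t ht) hA2 ht hs

end Market

/-! ### The fund and its depletion -/

section Paths

variable {Ω : Type*} {S : ℕ → Ω → ℝ} {A : ℕ → ℝ} {N : ℕ} {x₀ w₀ : ℝ}

theorem fund_succ (t : ℕ) (ω : Ω) : fund S A N x₀ w₀ (t + 1) ω =
    fund S A N x₀ w₀ t ω * (S (t + 1) ω / S t ω) - level S A N x₀ w₀ t ω := rfl

theorem level_succ (t : ℕ) (ω : Ω) : level S A N x₀ w₀ (t + 1) ω =
    if t + 1 < N then max (level S A N x₀ w₀ t ω) (fund S A N x₀ w₀ (t + 1) ω / A (t + 1))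
      else level S A N x₀ w₀ t ω := rfl

theorem level_pos (hw₀ : 0 < w₀) (t : ℕ) (ω : Ω) : 0 < level S A N x₀ w₀ t ω := by
  induction t with
  | zero => exact hw₀
  | succ t ih =>
    rw [level_succ]
    split_ifs
    · exact lt_max_of_lt_left ih
    · exact ih

theorem level_succ_of_fund_nonpos (hA : ∀ t, 1 ≤ t → t < N → 0 < A t) (hw₀ : 0 < w₀) {t : ℕ} {ω : Ω}
    (hX : fund S A N x₀ w₀ (t + 1) ω ≤ 0) :
    level S A N x₀ w₀ (t + 1) ω = level S A N x₀ w₀ t ω := by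
  rw [level_succ]
  split_ifs with ht
  · exact max_eq_left ((div_nonpos_of_nonpos_of_nonneg hX (hA _ (by omega) ht).le).trans
      (level_pos hw₀ t ω).le)
  · rfl

/-- The event that the fund is not depleted up to date `t`. -/
def alive (S : ℕ → Ω → ℝ) (A : ℕ → ℝ) (N : ℕ) (x₀ w₀ : ℝ) (t : ℕ) : Set Ω :=
  {ω | ∀ u ≤ t, 0 < fund S A N x₀ w₀ u ω}

theorem depletionTime_le_iff {t : ℕ} (ht : t ≤ N) (ω : Ω) :
    depletionTime S A N x₀ w₀ ω ≤ (t : ℕ∞) ↔ ω ∉ alive S A N x₀ w₀ t := by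
  simp only [alive, mem_ofPred_eq, not_forall, not_lt]
  constructor
  · intro h
    rcases Set.eq_empty_or_nonempty
      ((fun u : ℕ => (u : ℕ∞)) '' {u : ℕ | u ≤ N ∧ fund S A N x₀ w₀ u ω ≤ 0}) with he | hne
    · rw [depletionTime, he, sInf_empty] at h
      exact absurd h (by simp)
    · obtain ⟨u, hu, hu'⟩ := csInf_mem hne
      refine ⟨u, ?_, hu.2⟩
      have h1 : ((u : ℕ) : ℕ∞) ≤ t := by
        simp only at hu'
        rw [hu']
        exact h
      exact_mod_cast h1
  · rintro ⟨u, hut, hu⟩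
    have h1 : ((u : ℕ) : ℕ∞) ≤ t := by exact_mod_cast hut
    rw [depletionTime]
    have h2 : u ∈ {u : ℕ | u ≤ N ∧ fund S A N x₀ w₀ u ω ≤ 0} := ⟨hut.trans ht, hu⟩
    exact (sInf_le (mem_image_of_mem (fun u : ℕ => (u : ℕ∞)) h2)).trans h1

theorem lt_depletionTime_iff {t : ℕ} (ht : t ≤ N) (ω : Ω) :
    (t : ℕ∞) < depletionTime S A N x₀ w₀ ω ↔ ω ∈ alive S A N x₀ w₀ t := by
  rw [← not_le, depletionTime_le_iff ht, not_not]

theorem mem_alive_succ {t : ℕ} {ω : Ω} : ω ∈ alive S A N x₀ w₀ (t + 1) ↔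
    ω ∈ alive S A N x₀ w₀ t ∧ 0 < fund S A N x₀ w₀ (t + 1) ω := by
  simp only [alive, mem_ofPred_eq, Nat.le_succ_iff]
  constructor
  · exact fun h => ⟨fun u hu => h u (.inl hu), h _ (.inr rfl)⟩
  · rintro ⟨h1, h2⟩ u (hu | rfl)
    · exact h1 u hu
    · exact h2

theorem depletionTime_eq_succ_iff {t : ℕ} (ht : t + 1 ≤ N) (ω : Ω) :
    depletionTime S A N x₀ w₀ ω = ((t + 1 : ℕ) : ℕ∞) ↔
      ω ∈ alive S A N x₀ w₀ t ∧ fund S A N x₀ w₀ (t + 1) ω ≤ 0 := by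
  have h1 := depletionTime_le_iff (S := S) (A := A) (x₀ := x₀) (w₀ := w₀) ht ω
  have h2 := lt_depletionTime_iff (S := S) (A := A) (x₀ := x₀) (w₀ := w₀) (Nat.le_of_succ_le ht) ω
  rw [mem_alive_succ] at h1
  have h3 : ((t + 1 : ℕ) : ℕ∞) ≤ depletionTime S A N x₀ w₀ ω ↔
      (t : ℕ∞) < depletionTime S A N x₀ w₀ ω := by
    push_cast
    exact ENat.add_one_le_iff (by simp)
  rw [le_antisymm_iff, h1, h3, h2, not_and, not_lt]
  tauto

open Classical in
theorem claim_succ {t : ℕ} (ht : t + 1 ≤ N) (ω : Ω) : claim S A N x₀ w₀ (t + 1) ω =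
    (if ω ∈ alive S A N x₀ w₀ t then 0 else level S A N x₀ w₀ t ω) +
    (if ω ∈ alive S A N x₀ w₀ t ∧ fund S A N x₀ w₀ (t + 1) ω ≤ 0
      then -fund S A N x₀ w₀ (t + 1) ω else 0) := by
  rw [claim]
  simp only [depletionTime_le_iff (Nat.le_of_succ_le ht), depletionTime_eq_succ_iff ht, ite_not]
  congr 1
  split_ifs with h
  · rw [min_eq_right h.2]
  · rfl

theorem claim_of_mem_alive {t : ℕ} (ht : t ≤ N) {ω : Ω} (hω : ω ∈ alive S A N x₀ w₀ t) :
    claim S A N x₀ w₀ t ω = 0 := by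
  cases t with
  | zero => rfl
  | succ t =>
    have h1 := mem_alive_succ.1 hω
    rw [claim_succ ht, if_pos h1.1, if_neg (fun h => absurd h.2 (not_le.2 h1.2)), add_zero]

theorem claim_succ_of_depleting {t : ℕ} (ht : t + 1 ≤ N) {ω : Ω} (hω : ω ∈ alive S A N x₀ w₀ t)
    (hX : fund S A N x₀ w₀ (t + 1) ω ≤ 0) :
    claim S A N x₀ w₀ (t + 1) ω = -fund S A N x₀ w₀ (t + 1) ω := by
  rw [claim_succ ht, if_pos hω, if_pos ⟨hω, hX⟩, zero_add]

theorem claim_succ_of_notMem_alive {t : ℕ} (ht : t + 1 ≤ N) {ω : Ω}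
    (hω : ω ∉ alive S A N x₀ w₀ t) :
    claim S A N x₀ w₀ (t + 1) ω = level S A N x₀ w₀ t ω := by
  rw [claim_succ ht, if_neg hω, if_neg (fun h => hω h.1), add_zero]

/-- Along a nonnegative price path a depleted fund stays depleted. -/
theorem fund_nonpos_of_notMem_alive (hw₀ : 0 < w₀) {ω : Ω} (hS : ∀ t ≤ N, 0 ≤ S t ω) {t : ℕ}
    (ht : t ≤ N) (hω : ω ∉ alive S A N x₀ w₀ t) : fund S A N x₀ w₀ t ω ≤ 0 := by
  induction t with
  | zero => simpa [alive] using hω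
  | succ t ih =>
    by_contra hX
    have h1 : ω ∉ alive S A N x₀ w₀ t := fun h => hω (mem_alive_succ.2 ⟨h, not_le.1 hX⟩)
    refine hX ?_
    rw [fund_succ]
    have h2 := mul_nonpos_of_nonpos_of_nonneg (ih (by omega) h1)
      (div_nonneg (hS (t + 1) ht) (hS t (by omega)))
    linarith [level_pos (S := S) (A := A) (N := N) (x₀ := x₀) hw₀ t ω]

/-- After depletion the fund stays nonpositive, so the level is frozen and each of the `N - t`
remaining claims equals it. -/
theorem sum_claim_of_notMem_alive (hA : ∀ t, 1 ≤ t → t < N → 0 < A t) (hw₀ : 0 < w₀) {ω : Ω}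
    (hS : ∀ t ≤ N, 0 ≤ S t ω) {t : ℕ} (ht : t ≤ N) (hω : ω ∉ alive S A N x₀ w₀ t) :
    ∑ u ∈ Finset.Icc (t + 1) N, claim S A N x₀ w₀ u ω =
      ((N : ℝ) - t) * level S A N x₀ w₀ t ω := by
  induction hn : N - t generalizing t with
  | zero =>
    obtain rfl : t = N := by omega
    simp
  | succ n ih =>
    have ht' : t + 1 ≤ N := by omega
    have hω' : ω ∉ alive S A N x₀ w₀ (t + 1) := fun h => hω (mem_alive_succ.1 h).1
    have hX := fund_nonpos_of_notMem_alive hw₀ hS ht' hω'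
    rw [← Finset.insert_Icc_add_one_left_eq_Icc ht', Finset.sum_insert (by simp), ih ht' hω' (by omega),
      claim_succ_of_notMem_alive ht' hω, level_succ_of_fund_nonpos hA hw₀ hX]
    push_cast
    ring

theorem sum_claim_of_depleting (hA : ∀ t, 1 ≤ t → t < N → 0 < A t) (hw₀ : 0 < w₀) {ω : Ω}
    (hS : ∀ t ≤ N, 0 ≤ S t ω) {t : ℕ} (ht : t + 1 ≤ N) (hω : ω ∈ alive S A N x₀ w₀ t)
    (hX : fund S A N x₀ w₀ (t + 1) ω ≤ 0) :
    ∑ u ∈ Finset.Icc (t + 1) N, claim S A N x₀ w₀ u ω =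
      ((N : ℝ) - t - 1) * level S A N x₀ w₀ t ω - fund S A N x₀ w₀ (t + 1) ω := by
  have hω' : ω ∉ alive S A N x₀ w₀ (t + 1) := fun h => absurd (mem_alive_succ.1 h).2 (not_lt.2 hX)
  rw [← Finset.insert_Icc_add_one_left_eq_Icc ht, Finset.sum_insert (by simp),
    sum_claim_of_notMem_alive hA hw₀ hS ht hω', claim_succ_of_depleting ht hω hX,
    level_succ_of_fund_nonpos hA hw₀ hX]
  push_cast
  ring

/-- A zero price would leave the fund at minus the withdrawal. Thus scaling applies at the current
price while the fund survives. -/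
theorem price_ne_zero_of_mem_alive (hw₀ : 0 < w₀) {ω : Ω} (hS0 : S 0 ω = 1) {t : ℕ}
    (hω : ω ∈ alive S A N x₀ w₀ t) : S t ω ≠ 0 := by
  cases t with
  | zero => simp [hS0]
  | succ t =>
    intro h0
    have h1 := (mem_alive_succ.1 hω).2
    rw [fund_succ, h0, zero_div, mul_zero, zero_sub] at h1
    linarith [level_pos (S := S) (A := A) (N := N) (x₀ := x₀) hw₀ t ω]

end Paths

/-! ### Integrability and conditional values along the fund. -/

section Dynamics

variable {Ω : Type*} {m : MeasurableSpace Ω} {Q : Measure Ω} {ℱ : Filtration ℕ m}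
  {S : ℕ → Ω → ℝ} {κ : ℕ → Kernel ℝ ℝ} {A : ℕ → ℝ} {N : ℕ} {x₀ w₀ : ℝ}

theorem measurable_fund_level (hS : ∀ t, Measurable[ℱ t] (S t)) (t : ℕ) :
    Measurable[ℱ t] (fund S A N x₀ w₀ t) ∧ Measurable[ℱ t] (level S A N x₀ w₀ t) := by
  induction t with
  | zero => exact ⟨measurable_const, measurable_const⟩
  | succ t ih =>
    have hm := ℱ.mono (Nat.le_succ t)
    have h1 : Measurable[ℱ (t + 1)] (fund S A N x₀ w₀ (t + 1)) :=
      ((ih.1.mono hm le_rfl).mul ((hS (t + 1)).div ((hS t).mono hm le_rfl))).sub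
        (ih.2.mono hm le_rfl)
    refine ⟨h1, ?_⟩
    by_cases ht : t + 1 < N
    · have h2 := (ih.2.mono hm le_rfl).max (h1.div_const (A (t + 1)))
      rwa [show level S A N x₀ w₀ (t + 1) = fun ω => _ from
        funext fun ω => (level_succ t ω).trans (if_pos ht)]
    · have h2 := ih.2.mono hm le_rfl
      rwa [show level S A N x₀ w₀ (t + 1) = level S A N x₀ w₀ t from
        funext fun ω => (level_succ t ω).trans (if_neg ht)]

theorem measurableSet_alive (hS : ∀ t, Measurable[ℱ t] (S t)) (t : ℕ) :
    MeasurableSet[ℱ t] (alive S A N x₀ w₀ t) := by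
  have h1 : alive S A N x₀ w₀ t = ⋂ u ∈ Finset.range (t + 1), fund S A N x₀ w₀ u ⁻¹' Ioi 0 := by
    ext ω
    simp [alive]
  rw [h1]
  exact Finset.measurableSet_biInter _ fun u hu =>
    ℱ.mono (by simpa [Nat.lt_succ_iff] using hu) _
      ((measurable_fund_level hS u).1 measurableSet_Ioi)

variable [IsProbabilityMeasure Q] [∀ t, IsMarkovKernel (κ t)]

/-- The ratio has conditional mean one where `S t > 0`, and where `S t = 0` it is `0` by the
convention for division; so the `L¹` norm of `Y` does not increase. -/
theorem integrable_mul_price_ratio (hS : Martingale S ℱ Q) (hS0 : ∀ᵐ ω ∂Q, S 0 ω = 1)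
    (hA1 : AssumptionA1 Q ℱ S κ N) (hsc : IsScaling κ N) {t : ℕ} (ht : t < N) {Y : Ω → ℝ}
    (hY : Measurable[ℱ t] Y) (hi : Integrable Y Q) :
    Integrable (fun ω => Y ω * (S (t + 1) ω / S t ω)) Q := by
  have hl := hsc.law t ht
  have hF : Measurable[(ℱ t).prod inferInstance]
      (fun p : Ω × ℝ => Y p.1 * (p.2 / S t p.1)) :=
    (hY.comp (@measurable_fst Ω ℝ (ℱ t) _)).mul ((@measurable_snd Ω ℝ (ℱ t) _).div
      ((hS.1 t).measurable.comp (@measurable_fst Ω ℝ (ℱ t) _)))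
  refine (hA1.integrable_iff hS ht hF.stronglyMeasurable).2 ⟨?_, ?_⟩
  · filter_upwards [hA1.price_nonneg hS hS0 t ht.le] with ω hω
    rcases hω.eq_or_lt with h0 | hpos
    · simp [← h0]
    · rw [hsc.integrable_iff ht hpos]
      refine (hl.integrable.const_mul (Y ω)).congr (.of_forall fun r => ?_)
      simp [mul_div_cancel_left₀ _ hpos.ne']
  · have h1 : Integrable (fun ω => if S t ω = 0 then 0 else |Y ω|) Q := by
      have h2 : MeasurableSet {ω | S t ω = 0} :=
        ((hS.1 t).measurable.mono (ℱ.le t) le_rfl) (measurableSet_singleton 0)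
      refine (hi.abs.indicator h2.compl).congr (.of_forall fun ω => ?_)
      by_cases h0 : S t ω = 0 <;> simp [h0]
    refine h1.congr ?_
    filter_upwards [hA1.price_nonneg hS hS0 t ht.le] with ω hω
    rcases hω.eq_or_lt with h0 | hpos
    · simp [← h0]
    · rw [if_neg hpos.ne', hsc.integral_eq ht hpos]
      have h3 : ∫ r, ‖Y ω * (S t ω * r / S t ω)‖ ∂(κ t 1) = ∫ r, |Y ω| * r ∂(κ t 1) := by
        refine integral_congr_ae ?_
        filter_upwards [hl.nonneg] with r hr
        rw [mul_div_cancel_left₀ _ hpos.ne', norm_mul, Real.norm_of_nonneg hr, Real.norm_eq_abs]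
      rw [h3, integral_const_mul, hl.mean, mul_one]

theorem integrable_fund_level (hS : Martingale S ℱ Q) (hS0 : ∀ᵐ ω ∂Q, S 0 ω = 1)
    (hA1 : AssumptionA1 Q ℱ S κ N) (hsc : IsScaling κ N) : ∀ t ≤ N,
    Integrable (fund S A N x₀ w₀ t) Q ∧ Integrable (level S A N x₀ w₀ t) Q := by
  intro t
  induction t with
  | zero => exact fun _ => ⟨integrable_const _, integrable_const _⟩
  | succ t ih =>
    intro ht
    obtain ⟨hX, hw⟩ := ih (by omega)
    have h1 : Integrable (fund S A N x₀ w₀ (t + 1)) Q :=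
      (integrable_mul_price_ratio hS hS0 hA1 hsc ht
        (measurable_fund_level (fun t => (hS.1 t).measurable) t).1 hX).sub hw
    refine ⟨h1, ?_⟩
    by_cases ht : t + 1 < N
    · have h2 := hw.sup (h1.div_const (A (t + 1)))
      exact h2.congr (.of_forall fun ω => ((level_succ t ω).trans (if_pos ht)).symm)
    · exact hw.congr (.of_forall fun ω => ((level_succ t ω).trans (if_neg ht)).symm)

theorem integrable_claim (hS : Martingale S ℱ Q) (hS0 : ∀ᵐ ω ∂Q, S 0 ω = 1)
    (hA1 : AssumptionA1 Q ℱ S κ N) (hsc : IsScaling κ N) {t : ℕ} (ht : t ≤ N) :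
    Integrable (claim S A N x₀ w₀ t) Q := by
  cases t with
  | zero => exact integrable_const (0 : ℝ)
  | succ t =>
    have hm : ∀ t, Measurable[ℱ t] (S t) := fun t => (hS.1 t).measurable
    have ha : MeasurableSet (alive S A N x₀ w₀ t) := ℱ.le t _ (measurableSet_alive hm t)
    have hX : MeasurableSet {ω | fund S A N x₀ w₀ (t + 1) ω ≤ 0} :=
      ℱ.le (t + 1) _ ((measurable_fund_level hm (t + 1)).1 measurableSet_Iic)
    have hi := integrable_fund_level (A := A) (x₀ := x₀) (w₀ := w₀) hS hS0 hA1 hsc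
    have h1 := ((hi t (by omega)).2.indicator ha.compl).add
      ((hi (t + 1) ht).1.neg.indicator (ha.inter hX))
    refine h1.congr (.of_forall fun ω => ?_)
    simp only [claim_succ ht, Pi.add_apply]
    congr 1
    · by_cases hω : ω ∈ alive S A N x₀ w₀ t <;> simp [hω]
    · classical
      rw [indicator_apply]
      rfl

/-- A random variable that agrees on an event of `ℱ t` with an adapted one has the latter as its
conditional expectation there. -/
theorem condExp_eq_on_of_ae_eq {t : ℕ} {T Y : Ω → ℝ} {D : Set Ω} (hT : Integrable T Q)
    (hY : Measurable[ℱ t] Y) (hYi : Integrable Y Q) (hD : MeasurableSet[ℱ t] D)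
    (hTY : ∀ᵐ ω ∂Q, ω ∈ D → T ω = Y ω) :
    ∀ᵐ ω ∂Q, ω ∈ D → (Q[T | ℱ t]) ω = Y ω := by
  have h1 : D.indicator T =ᵐ[Q] D.indicator Y := by
    filter_upwards [hTY] with ω hω
    by_cases hωD : ω ∈ D
    · simp [hωD, hω hωD]
    · simp [hωD]
  have h2 := condExp_congr_ae (m := ℱ t) h1
  have h3 := condExp_of_stronglyMeasurable (μ := Q) (ℱ.le t)
    (hY.indicator hD).stronglyMeasurable (hYi.indicator (ℱ.le t _ hD))
  filter_upwards [h2, condExp_indicator hT hD] with ω hω hω' hωD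
  rw [hω', h3, indicator_of_mem hωD, indicator_of_mem hωD] at hω
  exact hω

/-- One backward step: if tomorrow's value is the portfolio payoff, then today's value is the
portfolio value. -/
theorem valueProcess_eq_hedgeValue_of_succ (hS : Martingale S ℱ Q) (hS0 : ∀ᵐ ω ∂Q, S 0 ω = 1)
    (hA1 : AssumptionA1 Q ℱ S κ N) (hsc : IsScaling κ N)
    (hA : ∀ t, 1 ≤ t → t < N → 0 < A t) (hw₀ : 0 < w₀) {t : ℕ} (ht : t < N)
    (hnext : ∀ᵐ ω ∂Q, ω ∈ alive S A N x₀ w₀ t →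
      valueProcess Q ℱ S A N x₀ w₀ (t + 1) ω = hedgePayoff κ A N t (level S A N x₀ w₀ t ω)
        (fund S A N x₀ w₀ (t + 1) ω + level S A N x₀ w₀ t ω)) :
    ∀ᵐ ω ∂Q, ω ∈ alive S A N x₀ w₀ t → valueProcess Q ℱ S A N x₀ w₀ t ω =
      hedgeValue κ A N t (level S A N x₀ w₀ t ω) (fund S A N x₀ w₀ t ω) := by
  have hm : ∀ t, Measurable[ℱ t] (S t) := fun t => (hS.1 t).measurable
  set D := alive S A N x₀ w₀ t
  have hD : MeasurableSet[ℱ t] D := measurableSet_alive hm t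
  have hsum : ∀ t, Integrable (fun ω => ∑ u ∈ Finset.Icc t N, claim S A N x₀ w₀ u ω) Q :=
    fun t => integrable_finsetSum _ fun u hu =>
      integrable_claim hS hS0 hA1 hsc (Finset.mem_Icc.1 hu).2
  obtain ⟨hXm, hwm⟩ := measurable_fund_level (A := A) (N := N) (x₀ := x₀) (w₀ := w₀) hm t
  let F : Ω × ℝ → ℝ := fun p => D.indicator (fun _ => (1 : ℝ)) p.1 *
    hedgePayoff κ A N t (level S A N x₀ w₀ t p.1)
      (fund S A N x₀ w₀ t p.1 * (p.2 / S t p.1))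
  have hpay : Continuous fun p : ℝ × ℝ => hedgePayoff κ A N t p.1 p.2 := by
    have := Weights.continuous_integrate_put_payoff (integrableOn_weights_g hsc hA t ht)
    unfold hedgePayoff
    fun_prop
  have hFm : StronglyMeasurable[(ℱ t).prod inferInstance] F := by
    have hfst : Measurable[(ℱ t).prod inferInstance, ℱ t] (Prod.fst : Ω × ℝ → Ω) :=
      @measurable_fst Ω ℝ (ℱ t) _
    have hsnd : Measurable[(ℱ t).prod inferInstance] (Prod.snd : Ω × ℝ → ℝ) :=
      @measurable_snd Ω ℝ (ℱ t) _
    have hF : Measurable[(ℱ t).prod inferInstance] F :=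
      ((measurable_const.indicator hD).comp hfst).mul
        (hpay.measurable.comp ((hwm.comp hfst).prodMk
          ((hXm.comp hfst).mul (hsnd.div ((hm t).comp hfst)))))
    exact hF.stronglyMeasurable
  have hFeq : (fun ω => F (ω, S (t + 1) ω)) =ᵐ[Q]
      D.indicator (Q[fun ω => ∑ u ∈ Finset.Icc (t + 1) N, claim S A N x₀ w₀ u ω | ℱ (t + 1)]) := by
    filter_upwards [hnext] with ω hω
    by_cases hωD : ω ∈ D
    · have h1 := hω hωD
      rw [fund_succ, sub_add_cancel] at h1
      simp only [F, indicator_of_mem hωD, one_mul]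
      exact h1.symm
    · simp [F, hωD]
  -- No growth bound on the payoff is needed: on the surviving paths it is a conditional
  -- expectation.
  have hFi : Integrable (fun ω => F (ω, S (t + 1) ω)) Q :=
    (integrable_condExp.indicator (ℱ.le t _ hD)).congr hFeq.symm
  have hF := hA1.condExp_eq hS ht hFm hFi
  have hind := condExp_indicator (hsum (t + 1)) (ℱ.mono (Nat.le_succ t) _ hD)
  have htower := condExp_condExp_of_le (μ := Q)
    (f := D.indicator fun ω => ∑ u ∈ Finset.Icc (t + 1) N, claim S A N x₀ w₀ u ω)
    (ℱ.mono (Nat.le_succ t)) (ℱ.le (t + 1))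
  have hcur := condExp_indicator (hsum t) hD
  have hshift : D.indicator (fun ω => ∑ u ∈ Finset.Icc t N, claim S A N x₀ w₀ u ω) =
      D.indicator (fun ω => ∑ u ∈ Finset.Icc (t + 1) N, claim S A N x₀ w₀ u ω) := by
    refine indicator_congr fun ω hω => ?_
    rw [← Finset.insert_Icc_add_one_left_eq_Icc ht.le, Finset.sum_insert (by simp),
      claim_of_mem_alive ht.le hω, zero_add]
  rw [hshift] at hcur
  filter_upwards [hcur, htower, condExp_congr_ae (m := ℱ t) hind,
    condExp_congr_ae (m := ℱ t) hFeq, hF, hS0, hA1.price_nonneg hS hS0 t ht.le]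
    with ω h1 h2 h3 h4 h5 h6 h7 hωD
  have hpos : 0 < S t ω := h7.lt_of_ne' (price_ne_zero_of_mem_alive hw₀ h6 hωD)
  rw [indicator_of_mem hωD] at h1
  have h8 : ∫ y, F (ω, y) ∂(κ t (S t ω)) =
      hedgeValue κ A N t (level S A N x₀ w₀ t ω) (fund S A N x₀ w₀ t ω) := by
    rw [hsc.integral_eq ht hpos, ← integral_hedgePayoff hsc hA ht (level_pos hw₀ t ω).le
      (hωD t le_rfl)]
    refine integral_congr_ae (.of_forall fun r => ?_)
    simp only [F, indicator_of_mem hωD, one_mul, mul_div_cancel_left₀ _ hpos.ne']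
  rw [← h8, ← h5, h4, ← h3, h2, h1]
  rfl

theorem valueProcess_eq (hS : Martingale S ℱ Q) (hS0 : ∀ᵐ ω ∂Q, S 0 ω = 1)
    (hA1 : AssumptionA1 Q ℱ S κ N) (hsc : IsScaling κ N)
    (hA : ∀ t, 1 ≤ t → t < N → 0 < A t) (hw₀ : 0 < w₀) : ∀ t < N,
    (∀ᵐ ω ∂Q, ω ∈ alive S A N x₀ w₀ t → valueProcess Q ℱ S A N x₀ w₀ t ω =
      hedgeValue κ A N t (level S A N x₀ w₀ t ω) (fund S A N x₀ w₀ t ω)) ∧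
    ∀ᵐ ω ∂Q, ω ∈ alive S A N x₀ w₀ t →
      valueProcess Q ℱ S A N x₀ w₀ (t + 1) ω = hedgePayoff κ A N t (level S A N x₀ w₀ t ω)
        (fund S A N x₀ w₀ (t + 1) ω + level S A N x₀ w₀ t ω) := by
  refine backward_induction N fun t ht ih => ?_
  have hm : ∀ t, Measurable[ℱ t] (S t) := fun t => (hS.1 t).measurable
  have hsum : Integrable (fun ω => ∑ u ∈ Finset.Icc (t + 1) N, claim S A N x₀ w₀ u ω) Q :=
    integrable_finsetSum _ fun u hu => integrable_claim hS hS0 hA1 hsc (Finset.mem_Icc.1 hu).2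
  suffices hnext : ∀ᵐ ω ∂Q, ω ∈ alive S A N x₀ w₀ t →
      valueProcess Q ℱ S A N x₀ w₀ (t + 1) ω = hedgePayoff κ A N t (level S A N x₀ w₀ t ω)
        (fund S A N x₀ w₀ (t + 1) ω + level S A N x₀ w₀ t ω) from
    ⟨valueProcess_eq_hedgeValue_of_succ hS hS0 hA1 hsc hA hw₀ ht hnext, hnext⟩
  have hmono := ℱ.mono (Nat.le_succ t)
  have hXm := (measurable_fund_level (A := A) (N := N) (x₀ := x₀) (w₀ := w₀) hm (t + 1)).1
  have hwm := ((measurable_fund_level (A := A) (N := N) (x₀ := x₀) (w₀ := w₀) hm t).2).mono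
    hmono le_rfl
  have hi := integrable_fund_level (A := A) (x₀ := x₀) (w₀ := w₀) hS hS0 hA1 hsc
  have hpath : ∀ᵐ ω ∂Q, ∀ t ≤ N, 0 ≤ S t ω :=
    ae_all_iff.2 fun t => Filter.eventually_imp_distrib_left.2 (hA1.price_nonneg hS hS0 t)
  -- If the fund depletes at `t + 1`, all remaining claims are already known at that date.
  have hdead : ∀ᵐ ω ∂Q, ω ∈ alive S A N x₀ w₀ t ∩ {ω | fund S A N x₀ w₀ (t + 1) ω ≤ 0} →
      valueProcess Q ℱ S A N x₀ w₀ (t + 1) ω =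
        ((N : ℝ) - t - 1) * level S A N x₀ w₀ t ω - fund S A N x₀ w₀ (t + 1) ω := by
    refine condExp_eq_on_of_ae_eq hsum ((hwm.const_mul _).sub hXm)
      (((hi t ht.le).2.const_mul _).sub (hi (t + 1) ht).1)
      ((hmono _ (measurableSet_alive hm t)).inter (hXm measurableSet_Iic)) ?_
    filter_upwards [hpath] with ω hω hωD
    exact sum_claim_of_depleting hA hw₀ hω ht hωD.1 hωD.2
  have hlive : ∀ᵐ ω ∂Q, ω ∈ alive S A N x₀ w₀ (t + 1) →
      valueProcess Q ℱ S A N x₀ w₀ (t + 1) ω = hedgePayoff κ A N t (level S A N x₀ w₀ t ω)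
        (fund S A N x₀ w₀ (t + 1) ω + level S A N x₀ w₀ t ω) := by
    by_cases ht' : t + 1 < N
    · filter_upwards [(ih ht').1] with ω hω hωD
      rw [hω hωD, hedgePayoff_eq_hedgeValue hsc hA ht' (level_pos hw₀ t ω)
        (by linarith [(mem_alive_succ.1 hωD).2]), add_sub_cancel_right, level_succ, if_pos ht']
    · obtain rfl : N = t + 1 := by omega
      have h1 := condExp_eq_on_of_ae_eq (Q := Q) (ℱ := ℱ) (t := t + 1) (Y := fun _ => (0 : ℝ)) hsum
        measurable_const (integrable_const _) (measurableSet_alive hm (t + 1))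
        (.of_forall fun ω hω => by simpa using claim_of_mem_alive le_rfl hω)
      filter_upwards [h1] with ω hω hωD
      refine (hω hωD).trans ?_
      have h2 := (mem_alive_succ.1 hωD).2
      simp [hedgePayoff, weights_last ht', Weights.integrate, h2.le]
  filter_upwards [hdead, hlive] with ω h1 h2 hωD
  by_cases hX : fund S A N x₀ w₀ (t + 1) ω ≤ 0
  · rw [h1 ⟨hωD, hX⟩, hedgePayoff_of_le hsc hA ht (level_pos hw₀ t ω) (by linarith)]
    ring
  · exact h2 (mem_alive_succ.2 ⟨hωD, not_le.1 hX⟩)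

end Dynamics

end RollUp

/-! ### Assembly of the statements. -/

theorem mainTheorem7 {Ω : Type*} {m : MeasurableSpace Ω} (Q : Measure Ω) [IsProbabilityMeasure Q]
    (ℱ : Filtration ℕ m) (S : ℕ → Ω → ℝ) (κ : ℕ → Kernel ℝ ℝ) [∀ t, IsMarkovKernel (κ t)]
    (N : ℕ) (A : ℕ → ℝ) (x₀ w₀ : ℝ)
    (hS : Martingale S ℱ Q) (hS0 : ∀ᵐ ω ∂Q, S 0 ω = 1)
    (hA1 : RollUp.AssumptionA1 Q ℱ S κ N) (hA2 : RollUp.AssumptionA2 κ N)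
    (hA : ∀ t, 1 ≤ t → t < N → 0 < A t) (hx₀ : 0 < x₀) (hw₀ : 0 < w₀) :
    -- the option sensitivities in the recursions exist (the Gamma almost everywhere)
    (∀ t < N, ∀ K, 0 < K →
      (∀ x, 0 < x → DifferentiableAt ℝ (RollUp.put κ t K) x ∧
        DifferentiableAt ℝ (RollUp.call κ t K) x) ∧
      ∀ᵐ x ∂(volume.restrict (Set.Ioi (0 : ℝ))), DifferentiableAt ℝ (RollUp.putDelta κ t K) x) ∧
    -- the integrals against the weight functions exist
    (∀ t < N,
      IntegrableOn (RollUp.weights κ A N t).g (Set.Icc 1 (1 + A (t + 1))) ∧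
      (∀ w, 0 < w → ∀ x, 0 < x →
        IntegrableOn (fun k => RollUp.put κ t (w * k) x * (RollUp.weights κ A N t).g k)
          (Set.Icc 1 (1 + A (t + 1))) ∧
        IntegrableOn (fun k => RollUp.putDelta κ t (w * k) x * (RollUp.weights κ A N t).g k)
          (Set.Icc 1 (1 + A (t + 1)))) ∧
      ∀ᵐ x ∂(volume.restrict (Set.Ioi (0 : ℝ))),
        IntegrableOn (fun k => RollUp.gamma κ t k x * (RollUp.weights κ A N t).g k)
          (Set.Icc 1 (1 + A (t + 1)))) ∧
    -- the value function is given by the hedge portfolio, whatever the asset price `s`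
    (∀ t < N, ∀ w, 0 < w → ∀ x, 0 < x → ∀ s, 0 < s →
      Integrable (fun y => RollUp.valueFun κ A N (t + 1) w (x * (y / s) - w) y) (κ t s) ∧
      RollUp.valueBar κ A N t w x s = RollUp.hedgeValue κ A N t w x) ∧
    -- positive homogeneity
    (∀ t < N, ∀ c, 0 < c → ∀ w, 0 < w → ∀ x, 0 < x → ∀ s, 0 < s →
      RollUp.valueBar κ A N t (c * w) (c * x) s = c * RollUp.valueBar κ A N t w x s) ∧
    -- replication, at every fund value `y` before the withdrawal at date `t + 1`
    (∀ t < N, ∀ w, 0 < w → ∀ y, 0 ≤ y → ∀ s, 0 < s →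
      RollUp.hedgePayoff κ A N t w y = RollUp.valueFun κ A N (t + 1) w (y - w) s) ∧
    -- the value process of the guarantee, and its semi-static hedge along the fund
    (∀ t ≤ N, Integrable (RollUp.claim S A N x₀ w₀ t) Q) ∧
    (∀ t < N, ∀ᵐ ω ∂Q, (t : ℕ∞) < RollUp.depletionTime S A N x₀ w₀ ω →
      RollUp.valueProcess Q ℱ S A N x₀ w₀ t ω =
        RollUp.hedgeValue κ A N t (RollUp.level S A N x₀ w₀ t ω) (RollUp.fund S A N x₀ w₀ t ω) ∧
      RollUp.valueProcess Q ℱ S A N x₀ w₀ (t + 1) ω =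
        RollUp.hedgePayoff κ A N t (RollUp.level S A N x₀ w₀ t ω)
          (RollUp.fund S A N x₀ w₀ (t + 1) ω + RollUp.level S A N x₀ w₀ t ω)) := by
  have hsc := hA1.isScaling hA2 hS hS0
  have hg := RollUp.integrableOn_weights_g hsc hA
  refine ⟨fun t ht K hK => ⟨fun x hx => ⟨(hsc.hasDerivAt_put ht hK hx).differentiableAt,
    (hsc.hasDerivAt_call ht hK hx).differentiableAt⟩, hsc.ae_differentiableAt_putDelta ht hK⟩,
    fun t ht => ⟨hg t ht, fun w hw x hx => ⟨?_, ?_⟩, ?_⟩,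
    fun t ht w hw x hx s hs => RollUp.valueBar_eq hsc hA ht hw hx hs,
    fun t ht c hc w hw x hx s hs => ?_,
    fun t ht w hw y hy s hs => RollUp.replication hsc hA t ht w hw y hy s (.inl hs),
    fun t ht => RollUp.integrable_claim hS hS0 hA1 hsc ht, fun t ht => ?_⟩
  · simp_rw [hsc.put_eq ht hx]
    exact RollUp.Weights.integrableOn_continuous_mul (hg t ht)
      (((hsc.law t ht).lipschitz_returnPut x).continuous.comp (continuous_const.mul continuous_id))
  · refine (RollUp.Weights.integrableOn_partialMean_mul (hsc.law t ht) (hg t ht)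
      (w := w) (x := x)).neg.congr_fun (fun k hk => ?_) measurableSet_Icc
    simp only [Pi.neg_apply]
    rw [hsc.putDelta_eq ht (mul_pos hw (one_pos.trans_le hk.1)) hx, neg_mul]
  · filter_upwards [(RollUp.Weights.integrable_returnGamma_mul (hsc.law t ht)
      (hg t ht)).prod_left_ae, ae_restrict_mem measurableSet_Ioi] with x hx hx0
    refine IntegrableOn.congr_fun hx (fun k hk => ?_) measurableSet_Icc
    simp only [hsc.gamma_eq ht (one_pos.trans_le hk.1) hx0]
  · rw [(RollUp.valueBar_eq hsc hA ht (mul_pos hc hw) (mul_pos hc hx) hs).2,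
      (RollUp.valueBar_eq hsc hA ht hw hx hs).2, RollUp.hedgeValue_mul hsc ht hc hx]
  · obtain ⟨h1, h2⟩ := RollUp.valueProcess_eq hS hS0 hA1 hsc hA hw₀ t ht (x₀ := x₀)
    filter_upwards [h1, h2] with ω h1 h2 hτ
    rw [RollUp.lt_depletionTime_iff ht.le] at hτ
    exact ⟨h1 hτ, h2 hτ⟩
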